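/- Let $N\ge 3$ be an integer and let $p\in\mathbb R$ satisfy $2\le p<N$ and $p\le \frac{2N}{N-2}$. Let $\sigma_1\in\mathbb R$ satisfy $1-\frac N2<\sigma_1\le \frac{2N}{p}-\frac N2$, and let $k_0\in\mathbb Z$. Fix a radial $\varphi\in\mathcal S(\mathbb R^N)$ supported in $\{\frac34\le|\xi|\le\frac83\}$ with $\sum_{j\in\mathbb Z}\varphi(2^{-j}\xi)=1$ for all $\xi\neq0$, and let $\dot\Delta_j u=\mathcal F^{-1}\big(\varphi(2^{-j}\cdot)\mathcal F u\big)$. For a tempered distribution $u$ on $\mathbb R^N$ (taken modulo polynomials), $s\in\mathbb R$ and $1\le q,r\le\infty$, put $$\|u\|_{\dot B^s_{q,r}}=\big\|\big(2^{ks}\|\dot\Delta_k u\|_{L^q}\big)_{k\in\mathbb Z}\big\|_{\ell^r},\qquad \|u\|^{\ell}_{\dot B^s_{q,r}}=\big\|\big(2^{ks}\|\dot\Delta_k u\|_{L^q}\big)_{k\le k_0}\big\|_{\ell^r},$$ and let $u\in\dot B^s_{q,r}$ mean $\|u\|_{\dot B^s_{q,r}}<\infty$. The product of $f$ and $g$ is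 $fg=\sum_{k,k'\in\mathbb Z}\dot\Delta_kf\,\dot\Delta_{k'}g$, whenever this double series of functions converges unconditionally in $\mathcal S'(\mathbb R^N)$; grouping its terms gives Bony's decomposition $fg=T_fg+T_gf+R(f,g)$. Then there is a constant $C$, depending only on $N,p,\sigma_1,\varphi,k_0$, such that the following holds for all $f,g$ for which the Besov norms on the right-hand side are finite; in each case the product on the left-hand side exists. 1. $\displaystyle \|fg\|_{\dot B^{-\sigma_1}_{2,\infty}}\le C\,\|f\|_{\dot B^{N/p}_{p,1}}\|g\|_{\dot B^{-\sigma_1}_{2,\infty}}$; 2. $\displaystyle \|fg\|^{\ell}_{\dot B^{-\sigma_1}_{2,\infty}}\le C\,\|f\|_{\dot B^{N/p-1}_{p,1}}\Big(\|g\|_{\dot B^{-\sigma_1+N/p-N/2+1}_{p,\infty}}+\|g\|_{\dot B^{-\sigma_1+2N/p-N+1}_{p,\infty}}\Big)$; 3. $\displaystyle \|fg\|^{\ell}_{\dot B^{-\sigma_1}_{2,\infty}}\le C\,\|f\|_{\dot B^{N/p-2}_{p,1}}\Big(\|g\|_{\dot B^{-\sigma_1+N/p-N/2+2}_{p,\infty}}+\|g\|_{\dot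 B^{-\sigma_1+2N/p-N+1}_{p,\infty}}\Big)$. If $f=g$, the low-frequency restriction and the second norm can be dropped in 3 and 2: 4. $\displaystyle \|ff\|_{\dot B^{-\sigma_1}_{2,\infty}}\le C\,\|f\|_{\dot B^{N/p-2}_{p,1}}\|f\|_{\dot B^{-\sigma_1+N/p-N/2+2}_{p,\infty}}$; 5. $\displaystyle \|ff\|_{\dot B^{-\sigma_1}_{2,\infty}}\le C\,\|f\|_{\dot B^{N/p-1}_{p,1}}\|f\|_{\dot B^{-\sigma_1+N/p-N/2+1}_{p,\infty}}$. -/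

import Mathlib

open MeasureTheory
open scoped ENNReal NNReal SchwartzMap

noncomputable section

namespace LittlewoodPaley

/-- `ℝ^N` with the Euclidean norm and Lebesgue measure. -/
abbrev RN (N : ℕ) : Type := EuclideanSpace ℝ (Fin N)

/-- A generator of a homogeneous dyadic partition of unity: a radial Schwartz function, supported
in the annulus `3/4 ≤ |ξ| ≤ 8/3`, with `∑_{j ∈ ℤ} φ(2^{-j} ξ) = 1` for `ξ ≠ 0`. -/
structure IsDyadicGenerator {N : ℕ} (φ : 𝓢(RN N, ℂ)) : Prop where
  radial : ∀ ξ η : RN N, ‖ξ‖ = ‖η‖ → φ ξ = φ η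
  support : Function.support φ ⊆ {ξ : RN N | 3 / 4 ≤ ‖ξ‖ ∧ ‖ξ‖ ≤ 8 / 3}
  partition : ∀ ξ : RN N, ξ ≠ 0 → HasSum (fun j : ℤ => φ ((2 : ℝ) ^ (-j) • ξ)) 1

/-- The homogeneous frequency localization operator `Δ̇_j` on tempered distributions: the Fourier
multiplier with symbol `ξ ↦ φ(2^{-j} ξ)`, where the Fourier transform is normalized with the kernel
`e^{-2π i x·ξ}`. -/
def dyadicBlock {N : ℕ} (φ : 𝓢(RN N, ℂ)) (j : ℤ) : 𝓢'(RN N, ℂ) →L[ℂ] 𝓢'(RN N, ℂ) :=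
  TemperedDistribution.fourierMultiplierCLM ℂ (fun ξ : RN N => φ ((2 : ℝ) ^ (-j) • ξ))

/-- The tempered distribution `u` is (given by integration against) the function `h`. -/
structure IsGivenBy {N : ℕ} (u : 𝓢'(RN N, ℂ)) (h : RN N → ℂ) : Prop where
  locallyIntegrable : LocallyIntegrable h
  integrable : ∀ ψ : 𝓢(RN N, ℂ), Integrable (fun x => ψ x * h x)
  apply_eq : ∀ ψ : 𝓢(RN N, ℂ), u ψ = ∫ x, ψ x * h x

/-- The function that gives a tempered distribution is unique almost everywhere. -/
theorem IsGivenBy.ae_eq {N : ℕ} {u : 𝓢'(RN N, ℂ)} {h₁ h₂ : RN N → ℂ}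
    (H₁ : IsGivenBy u h₁) (H₂ : IsGivenBy u h₂) : h₁ =ᵐ[volume] h₂ := by
  refine ae_eq_of_integral_contDiff_smul_eq H₁.locallyIntegrable H₂.locallyIntegrable ?_
  intro g hg hgc
  have hc : HasCompactSupport (Complex.ofRealCLM ∘ g) := hgc.comp_left rfl
  have e₁ := H₁.apply_eq (hc.toSchwartzMap (by fun_prop))
  have e₂ := H₂.apply_eq (hc.toSchwartzMap (by fun_prop))
  simpa using e₁.symm.trans e₂

/-- The `L^p` norm of a tempered distribution: the norm of the function that gives it, and `∞` if
there is none. -/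
def lpNorm {N : ℕ} (p : ℝ≥0∞) (u : 𝓢'(RN N, ℂ)) : ℝ≥0∞ :=
  ⨅ (h : RN N → ℂ) (_ : IsGivenBy u h), eLpNorm h p volume

/-- The homogeneous Besov norm `‖ 2^{ks} ‖Δ̇_k u‖_{L^p} ‖_{ℓ^r(ℤ)}`. Adding a polynomial to `u`
changes no `Δ̇_k u`, so this is a function of the class of `u` modulo polynomials. -/
def besovNorm {N : ℕ} (φ : 𝓢(RN N, ℂ)) (s : ℝ) (p r : ℝ≥0∞) (u : 𝓢'(RN N, ℂ)) : ℝ≥0∞ :=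
  eLpNorm (fun k : ℤ => (2 : ℝ≥0∞) ^ ((k : ℝ) * s) * lpNorm p (dyadicBlock φ k u)) r Measure.count

/-- The low-frequency part of the Besov norm: only the blocks with `k ≤ k₀` are counted. -/
def besovNormLow {N : ℕ} (φ : 𝓢(RN N, ℂ)) (k₀ : ℤ) (s : ℝ) (p r : ℝ≥0∞) (u : 𝓢'(RN N, ℂ)) :
    ℝ≥0∞ :=
  eLpNorm (fun k : ℤ =>
    if k ≤ k₀ then (2 : ℝ≥0∞) ^ ((k : ℝ) * s) * lpNorm p (dyadicBlock φ k u) else 0) r Measure.count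

/-- Membership in the homogeneous Besov space `Ḃ^s_{p,r}`, for a representative modulo
polynomials. -/
def MemBesov {N : ℕ} (φ : 𝓢(RN N, ℂ)) (s : ℝ) (p r : ℝ≥0∞) (u : 𝓢'(RN N, ℂ)) : Prop :=
  besovNorm φ s p r u < ∞

/-- `w` is the product `f g` of two tempered distributions modulo polynomials: the functions
`Δ̇_k f` and `Δ̇_l g` are multiplied pointwise, and `∑_{k, l} Δ̇_k f Δ̇_l g` converges
(unconditionally) to `w` in the space of tempered distributions. Grouping the pairs with
`k ≤ l - 2`, `l ≤ k - 2` and `|k - l| ≤ 1` gives the paraproducts `T_f g`, `T_g f` and the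
remainder `R(f, g)` of Bony's decomposition. -/
def IsProduct {N : ℕ} (φ : 𝓢(RN N, ℂ)) (f g w : 𝓢'(RN N, ℂ)) : Prop :=
  ∃ (F G : ℤ → RN N → ℂ) (P : ℤ × ℤ → 𝓢'(RN N, ℂ)),
    (∀ k, IsGivenBy (dyadicBlock φ k f) (F k)) ∧
    (∀ l, IsGivenBy (dyadicBlock φ l g) (G l)) ∧
    (∀ q, IsGivenBy (P q) (fun x => F q.1 x * G q.2 x)) ∧
    HasSum P w

/-- The product is unique. -/
theorem IsProduct.unique {N : ℕ} {φ : 𝓢(RN N, ℂ)} {f g w₁ w₂ : 𝓢'(RN N, ℂ)}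
    (H₁ : IsProduct φ f g w₁) (H₂ : IsProduct φ f g w₂) : w₁ = w₂ := by
  obtain ⟨F₁, G₁, P₁, hF₁, hG₁, hP₁, hw₁⟩ := H₁
  obtain ⟨F₂, G₂, P₂, hF₂, hG₂, hP₂, hw₂⟩ := H₂
  have hP : P₁ = P₂ := by
    funext q
    ext ψ
    rw [(hP₁ q).apply_eq, (hP₂ q).apply_eq]
    refine integral_congr_ae ?_
    filter_upwards [(hF₁ q.1).ae_eq (hF₂ q.1), (hG₁ q.2).ae_eq (hG₂ q.2)] with x hx hy
    rw [hx, hy]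
  subst hP
  exact hw₁.unique hw₂

end LittlewoodPaley

end

/-!
Split the product into the pairs of blocks with `k ≤ l - 4`, `l ≤ k - 4` and `|k - l| ≤ 3`. In a
paraproduct, Bernstein's inequality raises the integrability of the factor with the low frequency
from `L^p` to the exponent that Hölder's inequality needs to end in `L^2`, and the terms have
spectrum in dyadic annuli, so that at each frequency only boundedly many of them contribute. The
terms of the remainder only have spectrum in balls; there Hölder gives `L^r` with
`1/r = 1/p + 1/q`, Bernstein is applied to the block of the sum, and the tail over high frequencies
is summed by the `ℓ^1` norm of the first factor. All three series converge in `𝓢'` because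
the regularity of the sum exceeds `-N/2`: against a Schwartz function the blocks of high frequency
decay rapidly, and those of low frequency like `2^{jN/2}`.

With `ω = N (1/r - 1/2)` and `f ∈ Ḃ^α_{p,1}`, the sum for `T_f g` is controlled by the `ℓ^1` norm
of `f` as soon as `α ≤ ω`, whereas `T_g f` needs a norm of `g` of exponent `β' < ω`. The second norm
of `g` is the price for this, and the restriction to low frequencies absorbs the excess
`2^{j(β - β')}`. For `f = g` both paraproducts are of the first kind.
-/

noncomputable section

namespace LittlewoodPaley

open FourierTransform
open scoped Convolution
open ContinuousLinearMap (mul)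

section Convolution

variable {α : Type*} [MeasurableSpace α] {μ : Measure α}

/-- Jensen's inequality for the measure with density `k`, in Hölder form. -/
theorem lintegral_mul_rpow_le {k h : α → ℝ≥0∞} (hk : AEMeasurable k μ) (hh : AEMeasurable h μ)
    {a : ℝ} (ha : 1 ≤ a) :
    (∫⁻ x, k x * h x ∂μ) ^ a ≤ (∫⁻ x, k x ∂μ) ^ (a - 1) * ∫⁻ x, k x * h x ^ a ∂μ := by
  have ha0 : 0 < a := by linarith
  have ha1 : 0 ≤ 1 - a⁻¹ := sub_nonneg.2 (inv_le_one_of_one_le₀ ha)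
  have holder := ENNReal.lintegral_mul_norm_pow_le (μ := μ) hk (hk.mul (hh.pow_const a))
    ha1 (by positivity) (sub_add_cancel 1 a⁻¹)
  have split_weight (x : α) : k x ^ (1 - a⁻¹) * (k x * h x ^ a) ^ a⁻¹ = k x * h x := by
    rw [ENNReal.mul_rpow_of_nonneg _ _ (by positivity), ← mul_assoc,
      ← ENNReal.rpow_add_of_nonneg _ _ ha1 (by positivity), ENNReal.rpow_rpow_inv ha0.ne']
    simp
  simp only [Pi.mul_apply, split_weight] at holder
  refine (ENNReal.rpow_le_rpow holder ha0.le).trans_eq ?_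
  rw [ENNReal.mul_rpow_of_nonneg _ _ ha0.le, ENNReal.rpow_inv_rpow ha0.ne', ← ENNReal.rpow_mul]
  congr 2
  field_simp

theorem eLpNorm_le_of_eLpNorm_le_of_eLpNorm_top_le {E : Type*} [NormedAddCommGroup E] {u : α → E}
    {a b : ℝ≥0∞} (ha : a ≠ 0) (hab : a ≤ b) {D : ℝ≥0∞} (hD : eLpNorm u a μ ≤ D)
    (hD' : eLpNorm u ∞ μ ≤ D) : eLpNorm u b μ ≤ D := by
  rcases eq_or_ne b ∞ with rfl | hb
  · exact hD'
  rcases eq_or_ne D ∞ with rfl | hDt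
  · exact le_top
  have ha' : a ≠ ∞ := ne_top_of_le_ne_top hb hab
  have hb0 : b ≠ 0 := (ha.bot_lt.trans_le hab).ne'
  have ha0 : 0 < a.toReal := ENNReal.toReal_pos ha ha'
  have hab' : 0 ≤ b.toReal - a.toReal := sub_nonneg.2 (ENNReal.toReal_mono hb hab)
  rw [eLpNorm_eq_lintegral_rpow_enorm_toReal ha ha', one_div, ENNReal.rpow_inv_le_iff ha0] at hD
  rw [eLpNorm_eq_lintegral_rpow_enorm_toReal hb0 hb, one_div,
    ENNReal.rpow_inv_le_iff (by linarith)]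
  rw [eLpNorm_exponent_top] at hD'
  calc ∫⁻ x, ‖u x‖ₑ ^ b.toReal ∂μ
      ≤ ∫⁻ x, ‖u x‖ₑ ^ a.toReal * D ^ (b.toReal - a.toReal) ∂μ := by
        refine lintegral_mono_ae ?_
        filter_upwards [enorm_ae_le_eLpNormEssSup u μ] with x hx
        calc ‖u x‖ₑ ^ b.toReal = ‖u x‖ₑ ^ a.toReal * ‖u x‖ₑ ^ (b.toReal - a.toReal) := by
              rw [← ENNReal.rpow_add_of_nonneg _ _ ha0.le hab', add_sub_cancel]
          _ ≤ _ := by gcongr; exact hx.trans hD'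
    _ = (∫⁻ x, ‖u x‖ₑ ^ a.toReal ∂μ) * D ^ (b.toReal - a.toReal) :=
        lintegral_mul_const' _ _ (ENNReal.rpow_ne_top_of_nonneg hab' hDt)
    _ ≤ D ^ a.toReal * D ^ (b.toReal - a.toReal) := by gcongr
    _ = D ^ b.toReal := by
        rw [← ENNReal.rpow_add_of_nonneg _ _ ha0.le hab', add_sub_cancel]

variable {G : Type*} [AddCommGroup G] [MeasurableSpace G] {ν : Measure G}

theorem enorm_convolution_le (f g : G → ℂ) (y : G) :
    ‖(f ⋆[mul ℂ ℂ, ν] g) y‖ₑ ≤ ∫⁻ t, ‖g (y - t)‖ₑ * ‖f t‖ₑ ∂ν := by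
  simpa [convolution, enorm_mul, mul_comm] using
    enorm_integral_le_lintegral_enorm (μ := ν) fun t => f t * g (y - t)

variable [MeasurableAdd₂ G] [MeasurableNeg G] [ν.IsAddLeftInvariant] [ν.IsNegInvariant]
  {f g : G → ℂ}

theorem lintegral_enorm_comp_sub_mul_le (a a' : ℝ≥0∞) [a.HolderConjugate a']
    (hf : AEStronglyMeasurable f ν) (hg : AEStronglyMeasurable g ν) (y : G) :
    ∫⁻ t, ‖g (y - t)‖ₑ * ‖f t‖ₑ ∂ν ≤ eLpNorm f a ν * eLpNorm g a' ν := by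
  have hsub := Measure.measurePreserving_sub_left ν y
  have holder := eLpNorm_smul_le_mul_eLpNorm (p := a) (q := a') (r := 1)
    (hg.comp_measurePreserving hsub) hf
  rw [eLpNorm_one_eq_lintegral_enorm, eLpNorm_comp_measurePreserving hg hsub] at holder
  simpa [enorm_mul, mul_comm] using holder

theorem eLpNorm_convolution_top_le (a a' : ℝ≥0∞) [a.HolderConjugate a']
    (hf : AEStronglyMeasurable f ν) (hg : AEStronglyMeasurable g ν) :
    eLpNorm (f ⋆[mul ℂ ℂ, ν] g) ∞ ν ≤ eLpNorm f a ν * eLpNorm g a' ν := by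
  rw [eLpNorm_exponent_top]
  exact eLpNormEssSup_le_of_ae_enorm_bound <| .of_forall fun y =>
    (enorm_convolution_le f g y).trans (lintegral_enorm_comp_sub_mul_le a a' hf hg y)

theorem eLpNorm_convolution_le [SFinite ν] {a : ℝ≥0∞} (ha : 1 ≤ a)
    (hf : AEStronglyMeasurable f ν) (hg : MemLp g 1 ν) :
    eLpNorm (f ⋆[mul ℂ ℂ, ν] g) a ν ≤ eLpNorm f a ν * eLpNorm g 1 ν := by
  rcases eq_or_ne a ∞ with rfl | hat
  · exact eLpNorm_convolution_top_le ∞ 1 hf hg.1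
  have ha1 : 1 ≤ a.toReal := by simpa using ENNReal.toReal_mono hat ha
  have ha0 : 0 < a.toReal := by linarith
  have hg_ne : eLpNorm g 1 ν ≠ ∞ := hg.2.ne
  have hgsub (y : G) : AEMeasurable (fun t => ‖g (y - t)‖ₑ) ν :=
    (hg.1.comp_measurePreserving (Measure.measurePreserving_sub_left ν y)).enorm
  have hmeas : AEMeasurable (fun z : G × G => ‖g (z.1 - z.2)‖ₑ * ‖f z.2‖ₑ ^ a.toReal)
      (ν.prod ν) :=
    (hg.1.comp_quasiMeasurePreserving (quasiMeasurePreserving_sub ν ν)).enorm.mul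
      (hf.comp_snd.enorm.pow_const _)
  have jensen (y : G) : ‖(f ⋆[mul ℂ ℂ, ν] g) y‖ₑ ^ a.toReal ≤
      eLpNorm g 1 ν ^ (a.toReal - 1) * ∫⁻ t, ‖g (y - t)‖ₑ * ‖f t‖ₑ ^ a.toReal ∂ν := by
    rw [eLpNorm_one_eq_lintegral_enorm, ← lintegral_sub_left_eq_self _ y]
    exact (ENNReal.rpow_le_rpow (enorm_convolution_le f g y) ha0.le).trans
      (lintegral_mul_rpow_le (hgsub y) hf.enorm ha1)
  rw [eLpNorm_eq_lintegral_rpow_enorm_toReal (by positivity) hat,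
    eLpNorm_eq_lintegral_rpow_enorm_toReal (by positivity) hat, one_div,
    ENNReal.rpow_inv_le_iff ha0, ENNReal.mul_rpow_of_nonneg _ _ ha0.le,
    ENNReal.rpow_inv_rpow ha0.ne']
  calc ∫⁻ y, ‖(f ⋆[mul ℂ ℂ, ν] g) y‖ₑ ^ a.toReal ∂ν
      ≤ eLpNorm g 1 ν ^ (a.toReal - 1) *
          ∫⁻ y, ∫⁻ t, ‖g (y - t)‖ₑ * ‖f t‖ₑ ^ a.toReal ∂ν ∂ν := by
        rw [← lintegral_const_mul' _ _ (ENNReal.rpow_ne_top_of_nonneg (by linarith) hg_ne)]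
        exact lintegral_mono jensen
    _ = eLpNorm g 1 ν ^ (a.toReal - 1) *
          ∫⁻ t, eLpNorm g 1 ν * ‖f t‖ₑ ^ a.toReal ∂ν := by
        rw [lintegral_lintegral_swap hmeas, eLpNorm_one_eq_lintegral_enorm]
        congr 2 with t
        have hgt : AEMeasurable (fun y => ‖g (y - t)‖ₑ) ν :=
          (hg.1.comp_measurePreserving (measurePreserving_sub_right ν t)).enorm
        rw [lintegral_mul_const'' _ hgt, lintegral_sub_right_eq_self (‖g ·‖ₑ) t]
    _ = (∫⁻ t, ‖f t‖ₑ ^ a.toReal ∂ν) * eLpNorm g 1 ν ^ a.toReal := by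
        rw [lintegral_const_mul' _ _ hg_ne, ← mul_assoc, mul_comm]
        nth_rw 2 [← ENNReal.rpow_one (eLpNorm g 1 ν)]
        rw [← ENNReal.rpow_add_of_nonneg _ _ (by linarith) one_pos.le, sub_add_cancel]

theorem integrable_mul_convolution_integrand [SFinite ν] (a a' : ℝ≥0∞) [a.HolderConjugate a']
    {u : G → ℂ} (hu : Integrable u ν) (hf : MemLp f a ν) (hg : MemLp g a' ν) :
    Integrable (fun z : G × G => u z.1 * (f z.2 * g (z.1 - z.2))) (ν.prod ν) := by
  have hmeas : AEStronglyMeasurable (fun z : G × G => u z.1 * (f z.2 * g (z.1 - z.2)))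
      (ν.prod ν) := hu.1.comp_fst.mul (hf.1.convolution_integrand (mul ℂ ℂ) hg.1)
  have hM : eLpNorm f a ν * eLpNorm g a' ν < ∞ := ENNReal.mul_lt_top hf.2 hg.2
  refine ⟨hmeas, ?_⟩
  rw [hasFiniteIntegral_iff_enorm, lintegral_prod _ hmeas.enorm]
  calc ∫⁻ y, ∫⁻ t, ‖u y * (f t * g (y - t))‖ₑ ∂ν ∂ν
      = ∫⁻ y, ‖u y‖ₑ * ∫⁻ t, ‖g (y - t)‖ₑ * ‖f t‖ₑ ∂ν ∂ν := by
        simp_rw [enorm_mul, lintegral_const_mul' _ _ enorm_ne_top, mul_comm ‖f _‖ₑ]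
    _ ≤ ∫⁻ y, ‖u y‖ₑ * (eLpNorm f a ν * eLpNorm g a' ν) ∂ν := by
        gcongr with y
        exact lintegral_enorm_comp_sub_mul_le a a' hf.1 hg.1 y
    _ = (∫⁻ y, ‖u y‖ₑ ∂ν) * (eLpNorm f a ν * eLpNorm g a' ν) := lintegral_mul_const' _ _ hM.ne
    _ < ∞ := ENNReal.mul_lt_top hu.2 hM

theorem integral_mul_convolution [SFinite ν] (a a' : ℝ≥0∞) [a.HolderConjugate a']
    {u : G → ℂ} (hu : Integrable u ν) (hf : MemLp f a ν) (hg : MemLp g a' ν) :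
    ∫ y, u y * (f ⋆[mul ℂ ℂ, ν] g) y ∂ν = ∫ t, (∫ y, g (y - t) * u y ∂ν) * f t ∂ν := by
  have swap := integral_integral_swap (f := fun y t => u y * (f t * g (y - t)))
    (integrable_mul_convolution_integrand a a' hu hf hg)
  simp only [integral_const_mul] at swap
  refine swap.trans (integral_congr_ae (.of_forall fun t => ?_))
  simp only [← integral_mul_const]
  congr 1 with y
  ring

end Convolution

section Multiplier

variable {N : ℕ}

theorem exists_eLpNorm_convolution_le (κ : 𝓢(RN N, ℂ)) {a b : ℝ≥0∞} (ha : 1 ≤ a) (hab : a ≤ b) :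
    ∃ C : ℝ≥0, ∀ h : RN N → ℂ, AEStronglyMeasurable h volume →
      eLpNorm (h ⋆[mul ℂ ℂ] κ) b volume ≤ C * eLpNorm h a volume := by
  have := ENNReal.HolderConjugate.inv_one_sub_inv' ha
  have h1 : MemLp κ 1 volume := κ.memLp 1
  have h2 : MemLp κ (1 - a⁻¹)⁻¹ volume := κ.memLp _
  set D := eLpNorm κ 1 volume + eLpNorm κ (1 - a⁻¹)⁻¹ volume
  have hD : D ≠ ∞ := (ENNReal.add_lt_top.2 ⟨h1.2, h2.2⟩).ne
  refine ⟨D.toNNReal, fun h hh => ?_⟩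
  rw [ENNReal.coe_toNNReal hD, mul_comm]
  refine eLpNorm_le_of_eLpNorm_le_of_eLpNorm_top_le (by positivity) hab
    ((eLpNorm_convolution_le ha hh h1).trans ?_)
    ((eLpNorm_convolution_top_le a (1 - a⁻¹)⁻¹ hh h1.1).trans ?_)
  · gcongr
    exact le_self_add
  · gcongr
    exact le_add_self

/-- The dilate `ξ ↦ m (2^{-j} ξ)` of a Schwartz function, which carries frequencies of size `1`
to frequencies of size `2^j`. -/
def dilate (j : ℤ) (m : 𝓢(RN N, ℂ)) : 𝓢(RN N, ℂ) :=
  SchwartzMap.compCLMOfContinuousLinearEquiv ℂ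
    (ContinuousLinearEquiv.smulLeft (Units.mk0 ((2 : ℝ) ^ (-j)) (by positivity))) m

@[simp]
theorem dilate_apply (j : ℤ) (m : 𝓢(RN N, ℂ)) (ξ : RN N) :
    dilate j m ξ = m ((2 : ℝ) ^ (-j) • ξ) := rfl

theorem fourierInv_dilate_apply (j : ℤ) (m : 𝓢(RN N, ℂ)) (x : RN N) :
    (𝓕⁻ (dilate j m)) x = ((2 : ℂ) ^ j) ^ N * (𝓕⁻ m) ((2 : ℝ) ^ j • x) := by
  have rescale := Measure.integral_comp_smul (volume : Measure (RN N))
    (fun v => Real.fourierChar (inner ℝ v ((2 : ℝ) ^ j • x)) • m v) ((2 : ℝ) ^ (-j))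
  have hinner (v : RN N) : inner ℝ ((2 : ℝ) ^ (-j) • v) ((2 : ℝ) ^ j • x) = inner ℝ v x := by
    rw [real_inner_smul_left, real_inner_smul_right, ← mul_assoc, ← zpow_add₀ two_ne_zero]
    simp
  simp only [hinner, finrank_euclideanSpace_fin] at rescale
  rw [SchwartzMap.fourierInv_coe, SchwartzMap.fourierInv_coe, Real.fourierInv_eq,
    Real.fourierInv_eq]
  simp only [dilate_apply, rescale]
  simp [zpow_neg]

theorem eLpNorm_comp_two_zpow_smul (j : ℤ) (h : RN N → ℂ) (p : ℝ≥0∞) :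
    eLpNorm (fun x => h ((2 : ℝ) ^ j • x)) p volume =
      2 ^ (-(j * (N * p.toReal⁻¹)) : ℝ) * eLpNorm h p volume := by
  have hj : (2 : ℝ) ^ j ≠ 0 := by positivity
  have hc : ENNReal.ofReal |(((2 : ℝ) ^ j) ^ N)⁻¹| = 2 ^ (-(j * N) : ℝ) := by
    rw [abs_of_pos (by positivity), ← Real.rpow_intCast, ← Real.rpow_natCast,
      ← Real.rpow_mul zero_le_two, ← Real.rpow_neg zero_le_two,
      ← ENNReal.ofReal_rpow_of_pos two_pos, ENNReal.ofReal_ofNat]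
  have hmap := (Homeomorph.smulOfNeZero _ hj).measurableEmbedding.eLpNorm_map_measure
    (g := h) (p := p) (μ := volume)
  change eLpNorm h p (Measure.map ((2 : ℝ) ^ j • ·) volume) = _ at hmap
  rw [Measure.map_addHaar_smul _ hj, finrank_euclideanSpace_fin, hc,
    eLpNorm_smul_measure_of_ne_zero (by simp), smul_eq_mul, one_div, ENNReal.toReal_inv,
    ← ENNReal.rpow_mul, neg_mul, mul_assoc] at hmap
  exact hmap.symm

theorem convolution_fourierInv_dilate (j : ℤ) (m : 𝓢(RN N, ℂ)) (h : RN N → ℂ) (y : RN N) :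
    (h ⋆[mul ℂ ℂ] (𝓕⁻ (dilate j m) : 𝓢(RN N, ℂ))) y =
      ((fun x => h ((2 : ℝ) ^ (-j) • x)) ⋆[mul ℂ ℂ] (𝓕⁻ m : 𝓢(RN N, ℂ))) ((2 : ℝ) ^ j • y) := by
  have rescale := Measure.integral_comp_smul (volume : Measure (RN N))
    (fun t => h ((2 : ℝ) ^ (-j) • t) * (𝓕⁻ m) ((2 : ℝ) ^ j • y - t)) ((2 : ℝ) ^ j)
  have hpow : ((2 : ℂ) ^ j) ^ N * ((((2 : ℝ) ^ j) ^ N)⁻¹ : ℝ) = 1 := by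
    push_cast
    exact mul_inv_cancel₀ (pow_ne_zero _ (zpow_ne_zero _ two_ne_zero))
  simp only [convolution, ContinuousLinearMap.mul_apply', fourierInv_dilate_apply,
    mul_left_comm (h _), integral_const_mul, ← smul_sub, smul_smul,
    ← zpow_add₀ (two_ne_zero' ℝ), neg_add_cancel,
    zpow_zero, one_smul, finrank_euclideanSpace_fin] at rescale ⊢
  rw [rescale, abs_of_pos (by positivity), Complex.real_smul, ← mul_assoc, hpow, one_mul]

theorem exists_eLpNorm_convolution_dilate_le (m : 𝓢(RN N, ℂ)) {a b : ℝ≥0∞} (ha : 1 ≤ a)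
    (hab : a ≤ b) :
    ∃ C : ℝ≥0, ∀ (j : ℤ) (h : RN N → ℂ), AEStronglyMeasurable h volume →
      eLpNorm (h ⋆[mul ℂ ℂ] (𝓕⁻ (dilate j m) : 𝓢(RN N, ℂ))) b volume ≤
        C * 2 ^ (j * (N * (a.toReal⁻¹ - b.toReal⁻¹)) : ℝ) * eLpNorm h a volume := by
  obtain ⟨C, hC⟩ := exists_eLpNorm_convolution_le (𝓕⁻ m) ha hab
  refine ⟨C, fun j h hh => ?_⟩
  have hhj : AEStronglyMeasurable (fun x => h ((2 : ℝ) ^ (-j) • x)) volume :=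
    hh.comp_quasiMeasurePreserving
      (Measure.quasiMeasurePreserving_smul volume (by positivity : (2 : ℝ) ^ (-j) ≠ 0))
  rw [funext (convolution_fourierInv_dilate j m h), eLpNorm_comp_two_zpow_smul]
  refine (mul_le_mul_right (hC _ hhj) _).trans_eq ?_
  rw [eLpNorm_comp_two_zpow_smul, mul_sub, mul_sub, sub_eq_neg_add,
    ENNReal.rpow_add _ _ two_ne_zero ENNReal.ofNat_ne_top]
  push_cast
  ring_nf

/-- The transpose of the Fourier multiplier with symbol `m`, acting on Schwartz functions. -/
def testMultiplier (m ψ : 𝓢(RN N, ℂ)) : 𝓢(RN N, ℂ) :=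
  𝓕 (SchwartzMap.smulLeftCLM ℂ m (𝓕⁻ ψ))

theorem fourierMultiplier_apply (m ψ : 𝓢(RN N, ℂ)) (u : 𝓢'(RN N, ℂ)) :
    TemperedDistribution.fourierMultiplierCLM ℂ m u ψ = u (testMultiplier m ψ) := rfl

theorem fourierInv_testMultiplier (m ψ : 𝓢(RN N, ℂ)) (ξ : RN N) :
    (𝓕⁻ (testMultiplier m ψ)) ξ = m ξ * (𝓕⁻ ψ) ξ := by
  simp [testMultiplier, SchwartzMap.smulLeftCLM_apply_apply m.hasTemperateGrowth]

theorem fourier_neg_apply (θ : 𝓢(RN N, ℂ)) (ξ : RN N) : (𝓕 θ) (-ξ) = (𝓕⁻ θ) ξ := by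
  rw [SchwartzMap.fourier_coe, SchwartzMap.fourierInv_coe, Real.fourierInv_eq_fourier_neg]

theorem testMultiplier_eq_convolution (m ψ : 𝓢(RN N, ℂ)) :
    testMultiplier m ψ = SchwartzMap.convolution (mul ℂ ℂ) (𝓕 m) ψ := by
  have hinv : 𝓕⁻ (SchwartzMap.convolution (mul ℂ ℂ) (𝓕 m) ψ) =
      SchwartzMap.smulLeftCLM ℂ m (𝓕⁻ ψ) := by
    ext ξ
    rw [← fourier_neg_apply, SchwartzMap.fourier_convolution, SchwartzMap.pairing_apply_apply,
      SchwartzMap.smulLeftCLM_apply_apply m.hasTemperateGrowth, fourier_neg_apply,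
      fourier_neg_apply, fourierInv_fourier_eq, ContinuousLinearMap.mul_apply', smul_eq_mul]
  rw [testMultiplier, ← hinv, fourier_fourierInv_eq]

theorem testMultiplier_apply (m ψ : 𝓢(RN N, ℂ)) (x : RN N) :
    testMultiplier m ψ x = ∫ y, (𝓕⁻ m) (y - x) * ψ y := by
  rw [testMultiplier_eq_convolution, SchwartzMap.convolution_apply, convolution_eq_swap]
  simp [← fourier_neg_apply]

end Multiplier

section LpNorm

variable {N : ℕ} {u v : 𝓢'(RN N, ℂ)} {h : RN N → ℂ} {p a : ℝ≥0∞}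

theorem IsGivenBy.unique (hu : IsGivenBy u h) (hv : IsGivenBy v h) : u = v := by
  ext ψ
  rw [hu.apply_eq, hv.apply_eq]

theorem IsGivenBy.lpNorm_eq (H : IsGivenBy u h) (p : ℝ≥0∞) : lpNorm p u = eLpNorm h p volume :=
  le_antisymm (iInf₂_le h H) (le_iInf₂ fun _ H' => (eLpNorm_congr_ae (H.ae_eq H')).le)

theorem exists_isGivenBy_memLp (hu : lpNorm p u < ∞) : ∃ h, IsGivenBy u h ∧ MemLp h p volume := by
  simp only [lpNorm, iInf_lt_iff] at hu
  obtain ⟨h, H, hlt⟩ := hu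
  exact ⟨h, H, H.locallyIntegrable.aestronglyMeasurable, hlt⟩

theorem isGivenBy_zero : IsGivenBy (0 : 𝓢'(RN N, ℂ)) 0 where
  locallyIntegrable := locallyIntegrable_zero
  integrable ψ := by simp
  apply_eq ψ := by simp

@[simp]
theorem lpNorm_zero (p : ℝ≥0∞) : lpNorm p (0 : 𝓢'(RN N, ℂ)) = 0 := by
  rw [isGivenBy_zero.lpNorm_eq, eLpNorm_zero]

theorem IsGivenBy.add {k : RN N → ℂ} (hu : IsGivenBy u h) (hv : IsGivenBy v k) :
    IsGivenBy (u + v) (h + k) where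
  locallyIntegrable := hu.locallyIntegrable.add hv.locallyIntegrable
  integrable ψ := by
    simp only [Pi.add_apply, mul_add]
    exact (hu.integrable ψ).add (hv.integrable ψ)
  apply_eq ψ := by
    simp only [Pi.add_apply, mul_add]
    rw [integral_add (hu.integrable ψ) (hv.integrable ψ), ← hu.apply_eq, ← hv.apply_eq]
    rfl

theorem lpNorm_add_le (hp : 1 ≤ p) (u v : 𝓢'(RN N, ℂ)) :
    lpNorm p (u + v) ≤ lpNorm p u + lpNorm p v := by
  rcases eq_top_or_lt_top (lpNorm p u) with hu | hu
  · simp [hu]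
  rcases eq_top_or_lt_top (lpNorm p v) with hv | hv
  · simp [hv]
  obtain ⟨h, Hu, hh⟩ := exists_isGivenBy_memLp hu
  obtain ⟨k, Hv, hk⟩ := exists_isGivenBy_memLp hv
  rw [(Hu.add Hv).lpNorm_eq, Hu.lpNorm_eq, Hv.lpNorm_eq]
  exact eLpNorm_add_le hh.1 hk.1 hp

theorem isGivenBy_toTemperedDistribution [hp : Fact (1 ≤ p)] (hh : MemLp h p volume) :
    IsGivenBy (Lp.toTemperedDistribution (hh.toLp h) : 𝓢'(RN N, ℂ)) h where
  locallyIntegrable := hh.locallyIntegrable hp.out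
  integrable ψ := by
    have := ENNReal.HolderConjugate.inv_one_sub_inv' hp.out
    exact memLp_one_iff_integrable.1 (hh.mul' (ψ.memLp (1 - p⁻¹)⁻¹))
  apply_eq ψ := by
    rw [Lp.toTemperedDistribution_apply]
    refine integral_congr_ae ?_
    filter_upwards [hh.coeFn_toLp] with x hx
    rw [hx, smul_eq_mul]

theorem enorm_apply_le (p p' : ℝ≥0∞) [p.HolderConjugate p'] (u : 𝓢'(RN N, ℂ))
    (ψ : 𝓢(RN N, ℂ)) : ‖u ψ‖ₑ ≤ lpNorm p u * eLpNorm ψ p' volume := by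
  rcases eq_or_ne (eLpNorm ψ p' volume) 0 with h0 | h0
  · have hψ : ψ = 0 := DFunLike.coe_injective <|
      (ψ.continuous.ae_eq_iff_eq volume continuous_zero).1 <|
        (eLpNorm_eq_zero_iff ψ.continuous.aestronglyMeasurable
          (ENNReal.HolderConjugate.ne_zero p' p)).1 h0
    simp [hψ]
  rcases eq_top_or_lt_top (lpNorm p u) with hu | hu
  · simp [hu, ENNReal.top_mul h0]
  obtain ⟨h, H, hh⟩ := exists_isGivenBy_memLp hu
  calc ‖u ψ‖ₑ ≤ ∫⁻ x, ‖ψ x * h x‖ₑ := by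
        rw [H.apply_eq]
        exact enorm_integral_le_lintegral_enorm _
    _ = eLpNorm (h • ⇑ψ) 1 volume := by
        rw [eLpNorm_one_eq_lintegral_enorm]
        simp only [Pi.smul_apply', smul_eq_mul, mul_comm]
    _ ≤ eLpNorm h p volume * eLpNorm ψ p' volume :=
        eLpNorm_smul_le_mul_eLpNorm ψ.continuous.aestronglyMeasurable hh.1
    _ = lpNorm p u * eLpNorm ψ p' volume := by rw [H.lpNorm_eq]

theorem lpNorm_le_tsum {ι : Type*} (hp : 1 ≤ p) {P : ι → 𝓢'(RN N, ℂ)} {w : 𝓢'(RN N, ℂ)}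
    (hw : HasSum P w) : lpNorm p w ≤ ∑' i, lpNorm p (P i) := by
  have : Fact (1 ≤ p) := ⟨hp⟩
  by_cases hs : ∑' i, lpNorm p (P i) = ∞
  · exact hs ▸ le_top
  choose h hP hh using fun i =>
    exists_isGivenBy_memLp (ENNReal.lt_top_of_tsum_ne_top hs i)
  have he (i) : ‖(hh i).toLp (h i)‖ₑ = lpNorm p (P i) := by
    rw [(hP i).lpNorm_eq, Lp.enorm_def, eLpNorm_congr_ae (hh i).coeFn_toLp]
  have hsum : Summable fun i => (hh i).toLp (h i) := .of_enorm (by simpa only [he] using hs)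
  have hT := hsum.hasSum.map (Lp.toTemperedDistributionCLM ℂ (volume : Measure (RN N)) p)
    (Lp.toTemperedDistributionCLM ℂ (volume : Measure (RN N)) p).continuous
  have hPT : (⇑(Lp.toTemperedDistributionCLM ℂ (volume : Measure (RN N)) p) ∘
      fun i => (hh i).toLp (h i)) = P :=
    funext fun i => (isGivenBy_toTemperedDistribution (hh i)).unique (hP i)
  have hg := isGivenBy_toTemperedDistribution (Lp.memLp (∑' i, (hh i).toLp (h i)))
  rw [Lp.toLp_coeFn] at hg
  obtain rfl := hw.unique (hPT ▸ hT)
  calc lpNorm p _ = ‖∑' i, (hh i).toLp (h i)‖ₑ := by rw [Lp.enorm_def]; exact hg.lpNorm_eq p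
    _ ≤ ∑' i, ‖(hh i).toLp (h i)‖ₑ := enorm_tsum_le_tsum_enorm
    _ = ∑' i, lpNorm p (P i) := by simp only [he]

theorem IsGivenBy.fourierMultiplier (H : IsGivenBy u h) (m : 𝓢(RN N, ℂ)) (ha : 1 ≤ a)
    (hh : MemLp h a volume) :
    IsGivenBy (TemperedDistribution.fourierMultiplierCLM ℂ m u)
      (h ⋆[mul ℂ ℂ] (𝓕⁻ m : 𝓢(RN N, ℂ))) := by
  have := ENNReal.HolderConjugate.inv_one_sub_inv' ha
  have hκ : MemLp (𝓕⁻ m : 𝓢(RN N, ℂ)) (1 - a⁻¹)⁻¹ volume :=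
    (𝓕⁻ m : 𝓢(RN N, ℂ)).memLp _
  have hconv : MemLp (h ⋆[mul ℂ ℂ] (𝓕⁻ m : 𝓢(RN N, ℂ))) ∞ volume :=
    ⟨(hh.1.convolution_integrand (mul ℂ ℂ) hκ.1).integral_prod_right',
      (eLpNorm_convolution_top_le a _ hh.1 hκ.1).trans_lt (ENNReal.mul_lt_top hh.2 hκ.2)⟩
  refine ⟨hconv.locallyIntegrable le_top, fun ψ => ?_, fun ψ => ?_⟩
  · exact memLp_one_iff_integrable.1 (hconv.mul' (ψ.memLp 1))
  · rw [fourierMultiplier_apply, H.apply_eq, integral_mul_convolution a _ ψ.integrable hh hκ]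
    simp only [testMultiplier_apply]

theorem exists_lpNorm_fourierMultiplier_dilate_le (m : 𝓢(RN N, ℂ)) {b : ℝ≥0∞} (ha : 1 ≤ a)
    (hab : a ≤ b) :
    ∃ C : ℝ≥0, ∀ (j : ℤ) (u : 𝓢'(RN N, ℂ)),
      lpNorm b (TemperedDistribution.fourierMultiplierCLM ℂ (dilate j m) u) ≤
        C * 2 ^ (j * (N * (a.toReal⁻¹ - b.toReal⁻¹)) : ℝ) * lpNorm a u := by
  obtain ⟨C, hC⟩ := exists_eLpNorm_convolution_dilate_le m ha hab
  refine ⟨C + 1, fun j u => ?_⟩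
  rcases eq_top_or_lt_top (lpNorm a u) with hu | hu
  · simp [hu]
  obtain ⟨h, H, hh⟩ := exists_isGivenBy_memLp hu
  rw [(H.fourierMultiplier (dilate j m) ha hh).lpNorm_eq, H.lpNorm_eq]
  refine (hC j h hh.1).trans ?_
  gcongr
  exact_mod_cast le_self_add

end LpNorm

section Spectrum

open scoped Pointwise

variable {N : ℕ} {u v w : 𝓢'(RN N, ℂ)} {S T : Set (RN N)}

theorem ext_fourierInv {ψ η : 𝓢(RN N, ℂ)} (h : ∀ ξ, (𝓕⁻ ψ) ξ = (𝓕⁻ η) ξ) : ψ = η := by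
  have hinv : 𝓕⁻ ψ = 𝓕⁻ η := SchwartzMap.ext h
  rw [← fourier_fourierInv_eq (F := 𝓢(RN N, ℂ)) ψ, hinv, fourier_fourierInv_eq]

/-- The Fourier transform of `u` lives on `S`. Testing only against functions with `𝓕⁻ ψ = 0`
pointwise on `S`, rather than near `S`, makes the notion stronger than `supp 𝓕 u ⊆ S`; it is what
smooth multipliers supported in `S` produce. -/
def HasSpectrumIn (u : 𝓢'(RN N, ℂ)) (S : Set (RN N)) : Prop :=
  ∀ ψ : 𝓢(RN N, ℂ), (∀ ξ ∈ S, (𝓕⁻ ψ) ξ = 0) → u ψ = 0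

theorem HasSpectrumIn.mono (hu : HasSpectrumIn u S) (h : S ⊆ T) : HasSpectrumIn u T :=
  fun ψ hψ => hu ψ fun ξ hξ => hψ ξ (h hξ)

theorem hasSpectrumIn_fourierMultiplier (m : 𝓢(RN N, ℂ)) (u : 𝓢'(RN N, ℂ)) :
    HasSpectrumIn (TemperedDistribution.fourierMultiplierCLM ℂ m u) (Function.support m) := by
  intro ψ hψ
  have h0 : testMultiplier m ψ = 0 := ext_fourierInv fun ξ => by
    rw [fourierInv_testMultiplier, fourierInv_zero]
    by_cases hξ : m ξ = 0
    · simp [hξ]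
    · simp [hψ ξ hξ]
  rw [fourierMultiplier_apply, h0, map_zero]

theorem HasSpectrumIn.apply_congr (hu : HasSpectrumIn u S) {ψ η : 𝓢(RN N, ℂ)}
    (h : ∀ ξ ∈ S, (𝓕⁻ ψ) ξ = (𝓕⁻ η) ξ) : u ψ = u η := by
  rw [← sub_eq_zero, ← map_sub]
  refine hu _ fun ξ hξ => ?_
  rw [sub_eq_add_neg, fourierInv_add, fourierInv_neg]
  simp [h ξ hξ]

theorem HasSpectrumIn.fourierMultiplier_eq_self (hu : HasSpectrumIn u S) {m : 𝓢(RN N, ℂ)}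
    (hm : ∀ ξ ∈ S, m ξ = 1) : TemperedDistribution.fourierMultiplierCLM ℂ m u = u := by
  ext ψ
  rw [fourierMultiplier_apply]
  refine hu.apply_congr fun ξ hξ => ?_
  rw [fourierInv_testMultiplier, hm ξ hξ, one_mul]

theorem HasSpectrumIn.fourierMultiplier_eq_zero (hu : HasSpectrumIn u S) {m : 𝓢(RN N, ℂ)}
    (hm : ∀ ξ ∈ S, m ξ = 0) : TemperedDistribution.fourierMultiplierCLM ℂ m u = 0 := by
  ext ψ
  rw [fourierMultiplier_apply]
  refine hu _ fun ξ hξ => ?_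
  rw [fourierInv_testMultiplier, hm ξ hξ, zero_mul]

theorem fourier_compSubConst_apply (θ : 𝓢(RN N, ℂ)) (η y : RN N) :
    (𝓕 (SchwartzMap.compSubConstCLM ℂ (-η) θ)) y =
      Real.fourierChar (inner ℝ y η) • (𝓕 θ) y := by
  have htrans : ⇑(SchwartzMap.compSubConstCLM ℂ (-η) θ) = θ ∘ fun v => v + η := by
    funext v
    simp
  rw [SchwartzMap.fourier_coe, SchwartzMap.fourier_coe, htrans, real_inner_comm]
  exact congrFun (VectorFourier.fourierIntegral_comp_add_right Real.fourierChar volume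
    (innerₗ (RN N)) θ η) y

theorem fourierInv_translate_kernel_mul_eq_zero (m ψ : 𝓢(RN N, ℂ)) (x η : RN N)
    (h : ∀ ζ ∈ Function.support m, (𝓕⁻ ψ) (η + ζ) = 0) :
    (𝓕⁻ (SchwartzMap.smulLeftCLM ℂ (fun y => (𝓕⁻ m) (y - x)) ψ)) η = 0 := by
  have hg : Function.HasTemperateGrowth (fun y => (𝓕⁻ m) (y - x)) :=
    (𝓕⁻ m).hasTemperateGrowth.comp (by fun_prop)
  -- `e` is `ψ` modulated by the character `η`, so that `𝓕⁻ e` is `𝓕⁻ ψ` translated by `η`.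
  set e := 𝓕 (SchwartzMap.compSubConstCLM ℂ (-η) (𝓕⁻ ψ)) with he
  have h0 : testMultiplier m e = 0 := ext_fourierInv fun ζ => by
    rw [fourierInv_testMultiplier, he, fourierInv_fourier_eq, fourierInv_zero,
      SchwartzMap.compSubConstCLM_apply, sub_neg_eq_add, add_comm]
    by_cases hζ : m ζ = 0
    · simp [hζ]
    · simp [h ζ hζ]
  have h1 := testMultiplier_apply m e x
  rw [h0] at h1
  rw [SchwartzMap.fourierInv_coe, Real.fourierInv_eq]
  refine Eq.trans (integral_congr_ae (.of_forall fun y => ?_)) h1.symm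
  simp only [he, fourier_compSubConst_apply, SchwartzMap.smulLeftCLM_apply_apply hg,
    fourier_fourierInv_eq, smul_eq_mul, Circle.smul_def]
  ring

theorem hasSpectrumIn_mul {F G : RN N → ℂ} (hu : HasSpectrumIn u S) (hv : HasSpectrumIn v T)
    (Hu : IsGivenBy u F) (Hv : IsGivenBy v G) (Hw : IsGivenBy w fun x => F x * G x)
    {a : ℝ≥0∞} (ha : 1 ≤ a) (hF : MemLp F a volume) {m : 𝓢(RN N, ℂ)}
    (hm : ∀ ξ ∈ S, m ξ = 1) : HasSpectrumIn w (T + Function.support m) := by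
  have := ENNReal.HolderConjugate.inv_one_sub_inv' ha
  have hκ : MemLp (𝓕⁻ m : 𝓢(RN N, ℂ)) (1 - a⁻¹)⁻¹ volume :=
    (𝓕⁻ m : 𝓢(RN N, ℂ)).memLp _
  intro ψ hψ
  have reproduce : F =ᵐ[volume] F ⋆[mul ℂ ℂ] (𝓕⁻ m : 𝓢(RN N, ℂ)) := by
    have := Hu.fourierMultiplier m ha hF
    rw [hu.fourierMultiplier_eq_self hm] at this
    exact Hu.ae_eq this
  have inner_eq_zero (t : RN N) : ∫ y, (𝓕⁻ m) (y - t) * (ψ y * G y) = 0 := by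
    have hg : Function.HasTemperateGrowth (fun y => (𝓕⁻ m) (y - t)) :=
      (𝓕⁻ m).hasTemperateGrowth.comp (by fun_prop)
    have hshift (η : RN N) (hη : η ∈ T) :
        (𝓕⁻ (SchwartzMap.smulLeftCLM ℂ (fun y => (𝓕⁻ m) (y - t)) ψ)) η = 0 :=
      fourierInv_translate_kernel_mul_eq_zero m ψ t η fun ζ hζ => hψ _ (Set.add_mem_add hη hζ)
    have h0 := hv _ hshift
    rw [Hv.apply_eq] at h0
    simpa only [SchwartzMap.smulLeftCLM_apply_apply hg, smul_eq_mul, mul_assoc] using h0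
  calc w ψ = ∫ y, ψ y * (F y * G y) := Hw.apply_eq ψ
    _ = ∫ y, ψ y * G y * (F ⋆[mul ℂ ℂ] (𝓕⁻ m : 𝓢(RN N, ℂ))) y := by
        refine integral_congr_ae ?_
        filter_upwards [reproduce] with y hy
        rw [← hy]
        ring
    _ = ∫ t, (∫ y, (𝓕⁻ m) (y - t) * (ψ y * G y)) * F t :=
        integral_mul_convolution a _ (Hv.integrable ψ) hF hκ
    _ = 0 := by simp only [inner_eq_zero, zero_mul, integral_zero]

end Spectrum

section Annuli

open scoped Pointwise

variable {N : ℕ}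

/-- The closed annulus `r ≤ |ξ| ≤ R`. -/
def annulus (N : ℕ) (r R : ℝ) : Set (RN N) := {ξ | r ≤ ‖ξ‖ ∧ ‖ξ‖ ≤ R}

/-- A smooth cutoff that equals `1` for `|ξ| ≤ 3` and vanishes for `|ξ| ≥ 4`. -/
structure IsBallCutoff (χ : 𝓢(RN N, ℂ)) : Prop where
  eq_one : ∀ ξ : RN N, ‖ξ‖ ≤ 3 → χ ξ = 1
  eq_zero : ∀ ξ : RN N, 4 ≤ ‖ξ‖ → χ ξ = 0
  norm_one_sub_le : ∀ ξ : RN N, ‖1 - χ ξ‖ ≤ 1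

theorem exists_isBallCutoff (N : ℕ) : ∃ χ : 𝓢(RN N, ℂ), IsBallCutoff χ := by
  let b : ContDiffBump (0 : RN N) := ⟨3, 4, by norm_num, by norm_num⟩
  have hc : HasCompactSupport (Complex.ofRealCLM ∘ b) := b.hasCompactSupport.comp_left rfl
  refine ⟨hc.toSchwartzMap (by have := b.contDiff (n := ⊤); fun_prop),
    fun ξ hξ => ?_, fun ξ hξ => ?_, fun ξ => ?_⟩
  · have : b ξ = 1 := b.one_of_mem_closedBall (by simpa [b] using hξ)
    simp [this]
  · have : b ξ = 0 := b.zero_of_le_dist (by simpa [b] using hξ)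
    simp [this]
  · have hsub : (1 - (b ξ : ℂ)) = ((1 - b ξ : ℝ) : ℂ) := by push_cast; rfl
    simp only [HasCompactSupport.toSchwartzMap_toFun, Function.comp_apply,
      Complex.ofRealCLM_apply, hsub, Complex.norm_real, Real.norm_eq_abs]
    rw [abs_of_nonneg (sub_nonneg.2 b.le_one)]
    exact sub_le_self _ b.nonneg

theorem norm_two_zpow_neg_smul (j : ℤ) (ξ : RN N) : ‖(2 : ℝ) ^ (-j) • ξ‖ = ‖ξ‖ / 2 ^ j := by
  rw [norm_smul, norm_zpow, zpow_neg, Real.norm_ofNat, div_eq_inv_mul]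

theorem two_zpow_le_mul {k l : ℤ} (n : ℤ) (h : k ≤ l + n) : (2 : ℝ) ^ k ≤ 2 ^ n * 2 ^ l := by
  rw [← zpow_add₀ two_ne_zero, add_comm]
  exact zpow_le_zpow_right₀ one_le_two h

theorem support_dilate_subset_annulus {m : 𝓢(RN N, ℂ)} {r R : ℝ}
    (hm : Function.support m ⊆ annulus N r R) (j : ℤ) :
    Function.support (dilate j m) ⊆ annulus N (r * 2 ^ j) (R * 2 ^ j) := by
  intro ξ hξ
  obtain ⟨h1, h2⟩ := hm (show (2 : ℝ) ^ (-j) • ξ ∈ Function.support m from hξ)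
  rw [norm_two_zpow_neg_smul] at h1 h2
  exact ⟨(le_div_iff₀ (by positivity)).1 h1, (div_le_iff₀ (by positivity)).1 h2⟩

namespace IsBallCutoff

variable {χ : 𝓢(RN N, ℂ)}

theorem dilate_eq_one (hχ : IsBallCutoff χ) {j : ℤ} {ξ : RN N} (h : ‖ξ‖ ≤ 3 * 2 ^ j) :
    dilate j χ ξ = 1 := by
  rw [dilate_apply, hχ.eq_one]
  rw [norm_two_zpow_neg_smul]
  exact (div_le_iff₀ (by positivity)).2 h

theorem norm_lt_of_mem_support_dilate (hχ : IsBallCutoff χ) {j : ℤ} {ξ : RN N}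
    (h : ξ ∈ Function.support (dilate j χ)) : ‖ξ‖ < 4 * 2 ^ j := by
  contrapose! h
  rw [Function.notMem_support, dilate_apply]
  refine hχ.eq_zero _ ?_
  rw [norm_two_zpow_neg_smul]
  exact (le_div_iff₀ (by positivity)).2 h

end IsBallCutoff

variable {φ : 𝓢(RN N, ℂ)} {u v w : 𝓢'(RN N, ℂ)} {j k l : ℤ}

theorem hasSpectrumIn_dyadicBlock (hφ : Function.support φ ⊆ annulus N (3 / 4) (8 / 3))
    (j : ℤ) (u : 𝓢'(RN N, ℂ)) :
    HasSpectrumIn (dyadicBlock φ j u) (annulus N (3 / 4 * 2 ^ j) (8 / 3 * 2 ^ j)) :=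
  (hasSpectrumIn_fourierMultiplier (dilate j φ) u).mono (support_dilate_subset_annulus hφ j)

theorem hasSpectrumIn_dyadicBlock_closedBall (hφ : Function.support φ ⊆ annulus N (3 / 4) (8 / 3))
    (j : ℤ) (u : 𝓢'(RN N, ℂ)) :
    HasSpectrumIn (dyadicBlock φ j u) (Metric.closedBall 0 (3 * 2 ^ j)) :=
  (hasSpectrumIn_dyadicBlock hφ j u).mono fun ξ hξ => mem_closedBall_zero_iff.2 <|
    hξ.2.trans (by gcongr; norm_num)

theorem HasSpectrumIn.dyadicBlock_eq_zero {S : Set (RN N)} (hu : HasSpectrumIn u S)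
    (hφ : Function.support φ ⊆ annulus N (3 / 4) (8 / 3))
    (hS : Disjoint S (annulus N (3 / 4 * 2 ^ j) (8 / 3 * 2 ^ j))) : dyadicBlock φ j u = 0 :=
  hu.fourierMultiplier_eq_zero (m := dilate j φ) fun _ hξ => Function.notMem_support.1 fun h =>
    hS.le_bot ⟨hξ, support_dilate_subset_annulus hφ j h⟩

theorem HasSpectrumIn.dyadicBlock_eq_zero_of_closedBall
    (hu : HasSpectrumIn u (Metric.closedBall 0 (3 * 2 ^ l)))
    (hφ : Function.support φ ⊆ annulus N (3 / 4) (8 / 3)) (hj : l + 2 < j) :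
    dyadicBlock φ j u = 0 := by
  refine hu.dyadicBlock_eq_zero hφ (Set.disjoint_left.2 fun ξ hξ hξj => ?_)
  have hlj := two_zpow_le_mul (k := l) (l := j) (-3) (by omega)
  have hj0 : (0 : ℝ) < 2 ^ j := by positivity
  rw [mem_closedBall_zero_iff] at hξ
  norm_num at hlj
  linarith [hξj.1]

theorem HasSpectrumIn.dyadicBlock_eq_zero_of_annulus
    (hu : HasSpectrumIn u (annulus N (1 / 2 * 2 ^ l) (3 * 2 ^ l)))
    (hφ : Function.support φ ⊆ annulus N (3 / 4) (8 / 3)) (hj : 2 < |j - l|) :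
    dyadicBlock φ j u = 0 := by
  rcases lt_abs.1 hj with h | h
  · exact (hu.mono fun ξ hξ => mem_closedBall_zero_iff.2 hξ.2).dyadicBlock_eq_zero_of_closedBall
      hφ (by omega)
  · refine hu.dyadicBlock_eq_zero hφ (Set.disjoint_left.2 fun ξ hξ hξj => ?_)
    have hjl := two_zpow_le_mul (k := j) (l := l) (-3) (by omega)
    have hl0 : (0 : ℝ) < 2 ^ l := by positivity
    norm_num at hjl
    linarith [hξ.1, hξj.2]

theorem hasSpectrumIn_mul_annulus {F G : RN N → ℂ} {r R : ℝ}
    (hu : HasSpectrumIn u (Metric.closedBall 0 (3 * 2 ^ k)))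
    (hv : HasSpectrumIn v (annulus N r R)) (Hu : IsGivenBy u F) (Hv : IsGivenBy v G)
    (Hw : IsGivenBy w fun x => F x * G x) {a : ℝ≥0∞} (ha : 1 ≤ a) (hF : MemLp F a volume) :
    HasSpectrumIn w (annulus N (r - 4 * 2 ^ k) (R + 4 * 2 ^ k)) := by
  obtain ⟨χ, hχ⟩ := exists_isBallCutoff N
  refine (hasSpectrumIn_mul hu hv Hu Hv Hw ha hF fun ξ hξ =>
    hχ.dilate_eq_one (mem_closedBall_zero_iff.1 hξ)).mono ?_
  rintro _ ⟨η, hη, ζ, hζ, rfl⟩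
  have hζ' := hχ.norm_lt_of_mem_support_dilate hζ
  have h1 : ‖η‖ ≤ ‖η + ζ‖ + ‖ζ‖ := by simpa using norm_sub_le (η + ζ) ζ
  exact ⟨by linarith [hη.1], (norm_add_le η ζ).trans (add_le_add hη.2 hζ'.le)⟩

section ProductOfBlocks

variable {f g : 𝓢'(RN N, ℂ)} {F G : RN N → ℂ}
  (hφ : Function.support φ ⊆ annulus N (3 / 4) (8 / 3))
  (HF : IsGivenBy (dyadicBlock φ k f) F) (HG : IsGivenBy (dyadicBlock φ l g) G)
  (Hw : IsGivenBy w fun x => F x * G x) {a : ℝ≥0∞} (ha : 1 ≤ a) (hF : MemLp F a volume)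

include hφ HF HG Hw ha hF

theorem hasSpectrumIn_mul_blocks :
    HasSpectrumIn w (annulus N (3 / 4 * 2 ^ l - 4 * 2 ^ k) (8 / 3 * 2 ^ l + 4 * 2 ^ k)) :=
  hasSpectrumIn_mul_annulus (hasSpectrumIn_dyadicBlock_closedBall hφ k f)
    (hasSpectrumIn_dyadicBlock hφ l g) HF HG Hw ha hF

theorem hasSpectrumIn_mul_blocks_of_add_four_le (hkl : k + 4 ≤ l) :
    HasSpectrumIn w (annulus N (1 / 2 * 2 ^ l) (3 * 2 ^ l)) := by
  have hk := two_zpow_le_mul (k := k) (l := l) (-4) (by omega)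
  have hl0 : (0 : ℝ) < 2 ^ l := by positivity
  norm_num at hk
  exact (hasSpectrumIn_mul_blocks hφ HF HG Hw ha hF).mono fun ξ hξ =>
    ⟨by linarith [hξ.1], by linarith [hξ.2]⟩

theorem hasSpectrumIn_mul_blocks_of_le_add_three (hkl : k ≤ l + 3) :
    HasSpectrumIn w (Metric.closedBall 0 (3 * 2 ^ (l + 4))) := by
  have hk := two_zpow_le_mul 3 hkl
  have hl0 : (0 : ℝ) < 2 ^ l := by positivity
  norm_num at hk
  refine (hasSpectrumIn_mul_blocks hφ HF HG Hw ha hF).mono fun ξ hξ => ?_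
  rw [mem_closedBall_zero_iff, zpow_add₀ two_ne_zero]
  norm_num
  linarith [hξ.2]

end ProductOfBlocks

theorem exists_lpNorm_le_of_hasSpectrumIn_closedBall (N : ℕ) {a b : ℝ≥0∞} (ha : 1 ≤ a)
    (hab : a ≤ b) :
    ∃ C : ℝ≥0, ∀ (l : ℤ) (u : 𝓢'(RN N, ℂ)),
      HasSpectrumIn u (Metric.closedBall 0 (3 * 2 ^ l)) →
        lpNorm b u ≤ C * 2 ^ (l * (N * (a.toReal⁻¹ - b.toReal⁻¹)) : ℝ) * lpNorm a u := by
  obtain ⟨χ, hχ⟩ := exists_isBallCutoff N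
  obtain ⟨C, hC⟩ := exists_lpNorm_fourierMultiplier_dilate_le χ ha hab
  refine ⟨C, fun l u hu => ?_⟩
  have h := hC l u
  rwa [hu.fourierMultiplier_eq_self fun ξ hξ =>
    hχ.dilate_eq_one (mem_closedBall_zero_iff.1 hξ)] at h

end Annuli

section Pairing

variable {N : ℕ}

/-- A continuous gauge on test functions. Pairings bounded by such a gauge define tempered
distributions. -/
structure IsTestBound (Q : 𝓢(RN N, ℂ) → ℝ≥0∞) : Prop where
  continuous : Continuous Q
  map_zero : Q 0 = 0
  ne_top : ∀ ψ, Q ψ ≠ ∞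

theorem IsTestBound.add {Q₁ Q₂ : 𝓢(RN N, ℂ) → ℝ≥0∞} (h₁ : IsTestBound Q₁) (h₂ : IsTestBound Q₂) :
    IsTestBound fun ψ => Q₁ ψ + Q₂ ψ :=
  ⟨h₁.continuous.add h₂.continuous, by simp [h₁.map_zero, h₂.map_zero],
    fun ψ => ENNReal.add_ne_top.2 ⟨h₁.ne_top ψ, h₂.ne_top ψ⟩⟩

theorem isTestBound_eLpNorm (L : 𝓢(RN N, ℂ) →L[ℂ] 𝓢(RN N, ℂ)) (C : ℝ≥0) {p : ℝ≥0∞}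
    (hp : 1 ≤ p) : IsTestBound fun ψ => C * eLpNorm (L ψ) p volume := by
  have : Fact (1 ≤ p) := ⟨hp⟩
  have hnorm (ψ : 𝓢(RN N, ℂ)) : eLpNorm (L ψ) p volume =
      ‖SchwartzMap.toLpCLM ℂ ℂ p volume (L ψ)‖ₑ := by
    rw [SchwartzMap.toLpCLM_apply, Lp.enorm_def]
    exact (eLpNorm_congr_ae (SchwartzMap.coeFn_toLp _ _ _)).symm
  simp_rw [hnorm]
  refine ⟨(ENNReal.continuous_const_mul ENNReal.coe_ne_top).comp
    ((SchwartzMap.toLpCLM ℂ ℂ p volume).continuous.comp L.continuous).enorm,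
    by rw [map_zero, map_zero, enorm_zero, mul_zero],
    fun ψ => ENNReal.mul_ne_top ENNReal.coe_ne_top enorm_ne_top⟩

theorem exists_enorm_apply_le_of_closedBall (N : ℕ) {r : ℝ≥0∞} (hr : 1 ≤ r) :
    ∃ C : ℝ≥0, ∀ (l : ℤ) (u : 𝓢'(RN N, ℂ)),
      HasSpectrumIn u (Metric.closedBall 0 (3 * 2 ^ l)) → ∀ ψ : 𝓢(RN N, ℂ),
        ‖u ψ‖ₑ ≤ lpNorm r u * 2 ^ (l * (N * r.toReal⁻¹) : ℝ) * (C * eLpNorm ψ 1 volume) := by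
  obtain ⟨C, hC⟩ := exists_lpNorm_le_of_hasSpectrumIn_closedBall N hr le_top
  refine ⟨C, fun l u hu ψ => ?_⟩
  calc ‖u ψ‖ₑ ≤ lpNorm ∞ u * eLpNorm ψ 1 volume := enorm_apply_le ∞ 1 u ψ
    _ ≤ (C * 2 ^ (l * (N * (r.toReal⁻¹ - (∞ : ℝ≥0∞).toReal⁻¹)) : ℝ) * lpNorm r u) *
          eLpNorm ψ 1 volume := by gcongr; exact hC l u hu
    _ = _ := by
        rw [ENNReal.toReal_top, inv_zero, sub_zero]
        ring

theorem eLpNorm_fourierInv_two (ψ : 𝓢(RN N, ℂ)) :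
    eLpNorm (𝓕⁻ ψ : 𝓢(RN N, ℂ)) 2 volume = eLpNorm ψ 2 volume := by
  have h := SchwartzMap.norm_fourier_toL2_eq (𝓕⁻ ψ : 𝓢(RN N, ℂ))
  rw [fourier_fourierInv_eq, SchwartzMap.norm_toLp, SchwartzMap.norm_toLp] at h
  exact ((ENNReal.toReal_eq_toReal_iff' (ψ.eLpNorm_lt_top 2 volume).ne
    ((𝓕⁻ ψ : 𝓢(RN N, ℂ)).eLpNorm_lt_top 2 volume).ne).1 h).symm

/-- The map `ψ ↦ |ξ|^{2n} 𝓕⁻ ψ`, i.e. `(-Δ)^n ψ` on the Fourier side up to a constant. -/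
def weightedFourierInv (n : ℕ) : 𝓢(RN N, ℂ) →L[ℂ] 𝓢(RN N, ℂ) :=
  (SchwartzMap.smulLeftCLM ℂ (fun ξ : RN N => (((‖ξ‖ ^ 2) ^ n : ℝ) : ℂ))).comp
    (fourierInvCLM ℂ 𝓢(RN N, ℂ))

theorem norm_weightedFourierInv_apply (n : ℕ) (ψ : 𝓢(RN N, ℂ)) (ξ : RN N) :
    ‖weightedFourierInv n ψ ξ‖ = ‖ξ‖ ^ (2 * n) * ‖(𝓕⁻ ψ) ξ‖ := by
  have hg : Function.HasTemperateGrowth (fun ξ : RN N => (((‖ξ‖ ^ 2) ^ n : ℝ) : ℂ)) := by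
    fun_prop
  have happly : weightedFourierInv n ψ ξ = (((‖ξ‖ ^ 2) ^ n : ℝ) : ℂ) * (𝓕⁻ ψ) ξ :=
    SchwartzMap.smulLeftCLM_apply_apply hg _ _
  rw [happly, norm_mul, Complex.norm_real, Real.norm_of_nonneg (by positivity), pow_mul]

theorem fourierInv_sub_testMultiplier (m ψ : 𝓢(RN N, ℂ)) (ξ : RN N) :
    (𝓕⁻ (ψ - testMultiplier m ψ)) ξ = (1 - m ξ) * (𝓕⁻ ψ) ξ := by
  rw [sub_eq_add_neg, fourierInv_add, fourierInv_neg, sub_mul, one_mul,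
    ← fourierInv_testMultiplier, sub_eq_add_neg]
  rfl

theorem IsBallCutoff.eLpNorm_sub_testMultiplier_le {χ : 𝓢(RN N, ℂ)} (hχ : IsBallCutoff χ) (n : ℕ)
    (l : ℤ) (ψ : 𝓢(RN N, ℂ)) :
    eLpNorm (ψ - testMultiplier (dilate l χ) ψ) 2 volume ≤
      2 ^ (l * (-(2 * n)) : ℝ) * eLpNorm (weightedFourierInv n ψ) 2 volume := by
  have hc : (2 : ℝ≥0∞) ^ (l * (-(2 * n)) : ℝ) = ENNReal.ofReal (((2 : ℝ) ^ l) ^ (2 * n))⁻¹ := by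
    rw [← ENNReal.ofReal_ofNat 2, ENNReal.ofReal_rpow_of_pos two_pos, mul_neg,
      Real.rpow_neg zero_le_two, Real.rpow_mul zero_le_two, Real.rpow_intCast]
    norm_cast
  rw [hc, ← eLpNorm_fourierInv_two]
  refine eLpNorm_le_mul_eLpNorm_of_ae_le_mul (.of_forall fun ξ => ?_) 2
  rw [fourierInv_sub_testMultiplier, norm_mul, norm_weightedFourierInv_apply]
  rcases le_or_gt ‖ξ‖ (3 * 2 ^ l) with h | h
  · rw [hχ.dilate_eq_one h, sub_self, norm_zero, zero_mul]
    positivity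
  · have hl : (0 : ℝ) < 2 ^ l := by positivity
    rw [← mul_assoc]
    gcongr
    refine (hχ.norm_one_sub_le _).trans ?_
    rw [inv_mul_eq_div, one_le_div (by positivity)]
    gcongr
    linarith

/-- Only the frequencies `|ξ| ≥ 2^l / 2` of `ψ` are seen, where `|ξ|^{2n}` gains `2^{-2nl}`. -/
theorem enorm_apply_le_of_annulus (n : ℕ) {l : ℤ} {u : 𝓢'(RN N, ℂ)}
    (hu : HasSpectrumIn u (annulus N (1 / 2 * 2 ^ l) (3 * 2 ^ l))) (ψ : 𝓢(RN N, ℂ)) :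
    ‖u ψ‖ₑ ≤ lpNorm 2 u * 2 ^ (l * (-(2 * n)) : ℝ) *
      ((64 ^ n : ℝ≥0) * eLpNorm (weightedFourierInv n ψ) 2 volume) := by
  obtain ⟨χ, hχ⟩ := exists_isBallCutoff N
  have high : u ψ = u (ψ - testMultiplier (dilate (l - 3) χ) ψ) := by
    refine hu.apply_congr fun ξ hξ => ?_
    have h0 : dilate (l - 3) χ ξ = 0 := by
      by_contra h
      have := hχ.norm_lt_of_mem_support_dilate h
      rw [zpow_sub₀ two_ne_zero] at this
      norm_num at this
      linarith [hξ.1]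
    rw [fourierInv_sub_testMultiplier, h0, sub_zero, one_mul]
  have hexp : (2 : ℝ≥0∞) ^ (((l - 3 : ℤ) : ℝ) * (-(2 * n))) =
      2 ^ (l * (-(2 * n)) : ℝ) * (64 ^ n : ℝ≥0) := by
    have h64 : ((64 ^ n : ℝ≥0) : ℝ≥0∞) = 2 ^ (6 * n : ℝ) := by
      rw [ENNReal.rpow_mul]
      norm_num
    rw [h64, ← ENNReal.rpow_add _ _ two_ne_zero ENNReal.ofNat_ne_top]
    push_cast
    ring_nf
  calc ‖u ψ‖ₑ ≤ lpNorm 2 u * eLpNorm (ψ - testMultiplier (dilate (l - 3) χ) ψ) 2 volume := by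
        rw [high]
        exact enorm_apply_le 2 2 u _
    _ ≤ lpNorm 2 u * (2 ^ (((l - 3 : ℤ) : ℝ) * (-(2 * n))) *
          eLpNorm (weightedFourierInv n ψ) 2 volume) := by
        gcongr
        exact hχ.eLpNorm_sub_testMultiplier_le n (l - 3) ψ
    _ = _ := by
        rw [hexp]
        ring

end Pairing

section Sums

theorem two_rpow_add (x y : ℝ) : (2 : ℝ≥0∞) ^ (x + y) = 2 ^ x * 2 ^ y :=
  ENNReal.rpow_add _ _ two_ne_zero ENNReal.ofNat_ne_top

theorem two_rpow_mono {x y : ℝ} (h : x ≤ y) : (2 : ℝ≥0∞) ^ x ≤ 2 ^ y :=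
  ENNReal.rpow_le_rpow_of_exponent_le one_le_two h

theorem tsum_two_rpow_neg_abs_ne_top {ε : ℝ} (hε : 0 < ε) :
    ∑' l : ℤ, (2 : ℝ≥0∞) ^ (-(|(l : ℝ)| * ε)) ≠ ∞ := by
  have hx : (2 : ℝ≥0∞) ^ (-ε) < 1 :=
    ENNReal.rpow_lt_one_of_one_lt_of_neg ENNReal.one_lt_two (by linarith)
  have hg : ∑' n : ℕ, ((2 : ℝ≥0∞) ^ (-ε)) ^ n ≠ ∞ := by
    rw [ENNReal.tsum_geometric]
    exact ENNReal.inv_ne_top.2 (tsub_pos_of_lt hx).ne'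
  have hle (l : ℤ) (n : ℕ) (h : (n : ℝ) ≤ |(l : ℝ)|) :
      (2 : ℝ≥0∞) ^ (-(|(l : ℝ)| * ε)) ≤ ((2 : ℝ≥0∞) ^ (-ε)) ^ n := by
    rw [← ENNReal.rpow_mul_natCast]
    exact two_rpow_mono (by nlinarith)
  rw [tsum_of_nat_of_neg_add_one ENNReal.summable ENNReal.summable]
  refine ENNReal.add_ne_top.2 ⟨ne_top_of_le_ne_top hg (ENNReal.tsum_le_tsum fun n => hle _ n ?_),
    ne_top_of_le_ne_top hg (ENNReal.tsum_le_tsum fun n => hle _ n ?_)⟩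
  · rw [Int.cast_natCast, Nat.abs_cast]
  · push_cast
    rw [abs_neg, abs_of_nonneg (by positivity)]
    linarith

theorem tsum_two_rpow_window_le (s : ℝ) (n : ℕ) (j : ℤ) :
    ∑' m : ℤ, (2 : ℝ≥0∞) ^ (m * s : ℝ) * (if |j - m| ≤ n then 1 else 0) ≤
      (2 * n + 1) * 2 ^ (n * |s|) * 2 ^ (j * s : ℝ) := by
  have hterm (m : ℤ) : (2 : ℝ≥0∞) ^ (m * s : ℝ) * (if |j - m| ≤ n then 1 else 0) ≤
      if m ∈ Finset.Icc (j - n) (j + n) then 2 ^ (n * |s|) * 2 ^ (j * s : ℝ) else 0 := by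
    by_cases hm : |j - m| ≤ n
    · rw [if_pos hm, mul_one, if_pos (Finset.mem_Icc.2 (by rw [abs_le] at hm; omega)),
        ← two_rpow_add]
      have hle : (m - j : ℝ) * s ≤ n * |s| := by
        refine (le_abs_self _).trans ?_
        rw [abs_mul, abs_sub_comm]
        gcongr
        exact_mod_cast hm
      exact two_rpow_mono (by linarith)
    · rw [if_neg hm, mul_zero]
      exact zero_le
  refine (ENNReal.tsum_le_tsum hterm).trans_eq ?_
  have hcard : (j + n + 1 - (j - n)).toNat = 2 * n + 1 := by omega
  rw [tsum_eq_sum fun m hm => if_neg hm, Finset.sum_congr rfl fun m hm => if_pos hm,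
    Finset.sum_const, Int.card_Icc, nsmul_eq_mul, hcard, mul_assoc]
  push_cast
  rfl

theorem tsum_mul_comp_le {ι : Type*} {F : ι → ℝ≥0∞} {ℓ : ι → ℤ} {x : ℤ → ℝ≥0∞}
    (h : ∀ m, ∑' i : ℓ ⁻¹' {m}, F i ≤ x m) (c : ℤ → ℝ≥0∞) :
    ∑' i, F i * c (ℓ i) ≤ ∑' m, x m * c m := by
  rw [← ENNReal.tsum_fiberwise _ ℓ]
  refine ENNReal.tsum_le_tsum fun m => ?_
  calc ∑' i : ℓ ⁻¹' {m}, F i * c (ℓ i) = (∑' i : ℓ ⁻¹' {m}, F i) * c m := by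
        rw [← ENNReal.tsum_mul_right]
        exact tsum_congr fun i => by rw [i.2]
    _ ≤ x m * c m := by gcongr; exact h m

end Sums

section Series

variable {N : ℕ} {φ : 𝓢(RN N, ℂ)} {ι : Type*}

theorem exists_hasSum_of_enorm_le {P : ι → 𝓢'(RN N, ℂ)} {c : ι → ℝ≥0∞} (hc : ∑' i, c i ≠ ∞)
    {Q : 𝓢(RN N, ℂ) → ℝ≥0∞} (hQ : IsTestBound Q) (h : ∀ i ψ, ‖P i ψ‖ₑ ≤ c i * Q ψ) :
    ∃ w, HasSum P w := by
  have hle (ψ : 𝓢(RN N, ℂ)) : ∑' i, ‖P i ψ‖ₑ ≤ (∑' i, c i) * Q ψ := by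
    rw [← ENNReal.tsum_mul_right]
    exact ENNReal.tsum_le_tsum fun i => h i ψ
  have hs (ψ : 𝓢(RN N, ℂ)) : Summable fun i => P i ψ :=
    Summable.of_enorm (ne_top_of_le_ne_top (ENNReal.mul_ne_top hc (hQ.ne_top ψ)) (hle ψ))
  let L : 𝓢(RN N, ℂ) →ₗ[ℂ] ℂ :=
    { toFun := fun ψ => ∑' i, P i ψ
      map_add' := fun ψ η => by simpa only [map_add] using (hs ψ).tsum_add (hs η)
      map_smul' := fun z ψ => by
        simpa only [map_smul, RingHom.id_apply] using (hs ψ).tsum_const_smul z }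
  have hL : Continuous L := by
    refine continuous_of_continuousAt_zero L ?_
    rw [ContinuousAt, map_zero, tendsto_zero_iff_enorm_tendsto_zero]
    have h0 : Filter.Tendsto (fun ψ => (∑' i, c i) * Q ψ) (nhds 0) (nhds 0) := by
      simpa only [Function.comp_def, hQ.map_zero, mul_zero] using
        ((ENNReal.continuous_const_mul hc).comp hQ.continuous).tendsto 0
    exact tendsto_of_tendsto_of_tendsto_of_le_of_le tendsto_const_nhds h0
      (fun _ => zero_le) fun ψ => enorm_tsum_le_tsum_enorm.trans (hle ψ)
  refine ⟨ContinuousLinearMap.toPointwiseConvergenceCLM ℂ (RingHom.id ℂ) 𝓢(RN N, ℂ) ℂ ⟨L, hL⟩, ?_⟩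
  rw [HasSum, PointwiseConvergenceCLM.tendsto_iff_forall_tendsto]
  refine fun ψ => (hs ψ).hasSum.congr fun s => ?_
  simp

theorem exists_enorm_apply_le_of_annulus {σ : ℝ} (hσ : -(N / 2 : ℝ) < σ) :
    ∃ ε > 0, ∃ Q : 𝓢(RN N, ℂ) → ℝ≥0∞, IsTestBound Q ∧ ∀ (l : ℤ) (u : 𝓢'(RN N, ℂ)),
      HasSpectrumIn u (annulus N (1 / 2 * 2 ^ l) (3 * 2 ^ l)) → ∀ ψ : 𝓢(RN N, ℂ),
        ‖u ψ‖ₑ ≤ lpNorm 2 u * 2 ^ (l * -σ + -(|(l : ℝ)| * ε)) * Q ψ := by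
  obtain ⟨n, hn⟩ := exists_nat_gt (σ / 2)
  obtain ⟨C, hC⟩ := exists_enorm_apply_le_of_closedBall N one_le_two
  refine ⟨min (σ + N / 2) (2 * n - σ), lt_min (by linarith) (by linarith),
    fun ψ => C * eLpNorm ψ 1 volume + (64 ^ n : ℝ≥0) * eLpNorm (weightedFourierInv n ψ) 2 volume,
    (isTestBound_eLpNorm (.id ℂ _) C le_rfl).add (isTestBound_eLpNorm _ _ one_le_two),
    fun l u hu ψ => ?_⟩
  rcases le_or_gt l 0 with hl | hl
  · refine (hC l u (hu.mono fun ξ hξ => mem_closedBall_zero_iff.2 hξ.2) ψ).trans ?_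
    gcongr
    · exact one_le_two
    · have hl' : (l : ℝ) ≤ 0 := by exact_mod_cast hl
      rw [abs_of_nonpos hl', ENNReal.toReal_ofNat]
      nlinarith [min_le_left (σ + N / 2) (2 * n - σ)]
    · exact le_self_add
  · refine (enorm_apply_le_of_annulus n hu ψ).trans ?_
    gcongr
    · exact one_le_two
    · have hl' : (0 : ℝ) < l := by exact_mod_cast hl
      rw [abs_of_pos hl']
      nlinarith [min_le_right (σ + N / 2) (2 * n - σ)]
    · exact le_add_self

theorem exists_hasSum_of_annuli {σ : ℝ} (hσ : -(N / 2 : ℝ) < σ) {ℓ : ι → ℤ}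
    {P : ι → 𝓢'(RN N, ℂ)} {A : ℝ≥0∞} (hA : A ≠ ∞)
    (hP : ∀ i, HasSpectrumIn (P i) (annulus N (1 / 2 * 2 ^ ℓ i) (3 * 2 ^ ℓ i)))
    (hPA : ∀ m, ∑' i : ℓ ⁻¹' {m}, lpNorm 2 (P i) ≤ A * 2 ^ (m * σ : ℝ)) : ∃ w, HasSum P w := by
  obtain ⟨ε, hε, Q, hQ, hPQ⟩ := exists_enorm_apply_le_of_annulus hσ
  refine exists_hasSum_of_enorm_le ?_ hQ fun i => hPQ (ℓ i) (P i) (hP i)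
  refine ne_top_of_le_ne_top (ENNReal.mul_ne_top hA (tsum_two_rpow_neg_abs_ne_top hε))
    ((tsum_mul_comp_le hPA fun m => 2 ^ (m * -σ + -(|(m : ℝ)| * ε))).trans_eq ?_)
  rw [← ENNReal.tsum_mul_left]
  refine tsum_congr fun m => ?_
  rw [mul_assoc, ← two_rpow_add]
  ring_nf

theorem exists_enorm_apply_le_min_of_closedBall (N : ℕ) {r : ℝ≥0∞} (hr : 1 ≤ r) :
    ∃ Q : 𝓢(RN N, ℂ) → ℝ≥0∞, IsTestBound Q ∧ ∀ (l : ℤ) (u : 𝓢'(RN N, ℂ)),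
      HasSpectrumIn u (Metric.closedBall 0 (3 * 2 ^ l)) → ∀ ψ : 𝓢(RN N, ℂ),
        ‖u ψ‖ₑ ≤ lpNorm r u * min 1 (2 ^ (l * (N * r.toReal⁻¹) : ℝ)) * Q ψ := by
  obtain ⟨C, hC⟩ := exists_enorm_apply_le_of_closedBall N hr
  have hconj := ENNReal.HolderConjugate.inv_one_sub_inv' hr
  set r' := (1 - r⁻¹)⁻¹
  have hr' : 1 ≤ r' := (ENNReal.HolderConjugate.symm (p := r) (q := r')).one_le
  refine ⟨_, (isTestBound_eLpNorm (.id ℂ _) C le_rfl).add (isTestBound_eLpNorm (.id ℂ _) 1 hr'),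
    fun l u hu ψ => ?_⟩
  rcases min_choice 1 ((2 : ℝ≥0∞) ^ (l * (N * r.toReal⁻¹) : ℝ)) with h | h <;> rw [h]
  · rw [mul_one, ENNReal.coe_one, one_mul]
    exact (enorm_apply_le r r' u ψ).trans (mul_le_mul_right le_add_self _)
  · exact (hC l u hu ψ).trans (mul_le_mul_right le_self_add _)

theorem exists_hasSum_of_balls {r : ℝ≥0∞} (hr : 1 ≤ r) {σ : ℝ} (hσ : -(N / 2 : ℝ) < σ) {ℓ : ι → ℤ}
    {P : ι → 𝓢'(RN N, ℂ)} {R : ℝ≥0∞} (hR : R ≠ ∞)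
    (hP : ∀ i, HasSpectrumIn (P i) (Metric.closedBall 0 (3 * 2 ^ ℓ i)))
    (hPR : ∀ j, ∑' i : {i | j ≤ ℓ i + 2}, lpNorm r (P i) ≤
      R * 2 ^ (j * (σ - N * (r.toReal⁻¹ - 2⁻¹)) : ℝ)) : ∃ w, HasSum P w := by
  obtain ⟨Q, hQ, hPQ⟩ := exists_enorm_apply_le_min_of_closedBall N hr
  refine exists_hasSum_of_enorm_le ?_ hQ fun i => hPQ (ℓ i) (P i) (hP i)
  have hfiber (m : ℤ) : ∑' i : ℓ ⁻¹' {m}, lpNorm r (P i) ≤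
      R * 2 ^ (m * (σ - N * (r.toReal⁻¹ - 2⁻¹)) : ℝ) := by
    refine (ENNReal.tsum_mono_subtype (fun i => lpNorm r (P i)) fun i hi => ?_).trans (hPR m)
    have hi' : ℓ i = m := hi
    exact hi'.symm.le.trans (by omega)
  let low (m : ℤ) : ℝ≥0∞ := if m < 0 then 2 ^ (m * (N * r.toReal⁻¹) : ℝ) else 0
  have hlow : ∑' i, lpNorm r (P i) * low (ℓ i) ≠ ∞ := by
    refine ne_top_of_le_ne_top (ENNReal.mul_ne_top hR (tsum_two_rpow_neg_abs_ne_top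
      (by linarith : 0 < σ + N / 2))) ((tsum_mul_comp_le hfiber low).trans ?_)
    rw [← ENNReal.tsum_mul_left]
    refine ENNReal.tsum_le_tsum fun m => ?_
    by_cases hm : m < 0
    · have hm' : (m : ℝ) < 0 := by exact_mod_cast hm
      rw [show low m = _ from if_pos hm, mul_assoc, ← two_rpow_add, abs_of_neg hm']
      ring_nf
      rfl
    · rw [show low m = 0 from if_neg hm, mul_zero]
      exact zero_le
  have hhigh : ∑' i, {i | 0 ≤ ℓ i + 2}.indicator (fun i => lpNorm r (P i)) i ≠ ∞ := by
    rw [← tsum_subtype]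
    exact ne_top_of_le_ne_top (ENNReal.mul_ne_top hR (by simp)) (hPR 0)
  refine ne_top_of_le_ne_top (ENNReal.add_ne_top.2 ⟨hlow, hhigh⟩) ?_
  rw [← ENNReal.tsum_add]
  refine ENNReal.tsum_le_tsum fun i => ?_
  rcases lt_or_ge (ℓ i) 0 with hi | hi
  · rw [show low (ℓ i) = _ from if_pos hi]
    exact (mul_le_mul_right (min_le_right _ _) _).trans le_self_add
  · rw [Set.indicator_of_mem (show i ∈ {i | 0 ≤ ℓ i + 2} from by
      rw [Set.mem_ofPred_eq]
      omega)]
    exact (mul_le_mul_right (min_le_left _ _) _).trans (by rw [mul_one]; exact le_add_self)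

/-- Only the pieces with `|ℓ i - j| ≤ 2` contribute to the block of index `j`. -/
theorem exists_lpNorm_dyadicBlock_le_of_annuli (hφ : Function.support φ ⊆ annulus N (3 / 4) (8 / 3))
    (σ : ℝ) (ℓ : ι → ℤ) :
    ∃ C : ℝ≥0, ∀ (P : ι → 𝓢'(RN N, ℂ)) (w : 𝓢'(RN N, ℂ)) (A : ℝ≥0∞), HasSum P w →
      (∀ i, HasSpectrumIn (P i) (annulus N (1 / 2 * 2 ^ ℓ i) (3 * 2 ^ ℓ i))) →
      (∀ m, ∑' i : ℓ ⁻¹' {m}, lpNorm 2 (P i) ≤ A * 2 ^ (m * σ : ℝ)) →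
      ∀ j : ℤ, lpNorm 2 (dyadicBlock φ j w) ≤ C * A * 2 ^ (j * σ : ℝ) := by
  obtain ⟨C, hC⟩ := exists_lpNorm_fourierMultiplier_dilate_le φ one_le_two (le_refl (2 : ℝ≥0∞))
  refine ⟨C * ((2 * 2 + 1) * 2 ^ (2 * |σ|)), fun P w A hw hP hPA j => ?_⟩
  have hblock (i : ι) : lpNorm 2 (dyadicBlock φ j (P i)) ≤
      lpNorm 2 (P i) * (C * if |j - ℓ i| ≤ 2 then 1 else 0) := by
    by_cases hi : |j - ℓ i| ≤ 2
    · rw [if_pos hi, mul_one, mul_comm]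
      refine (hC j (P i)).trans_eq ?_
      rw [sub_self, mul_zero, mul_zero, ENNReal.rpow_zero, mul_one]
    · rw [(hP i).dyadicBlock_eq_zero_of_annulus hφ (not_le.1 hi), lpNorm_zero]
      exact zero_le
  calc lpNorm 2 (dyadicBlock φ j w)
      ≤ ∑' i, lpNorm 2 (dyadicBlock φ j (P i)) :=
        lpNorm_le_tsum one_le_two (hw.map (dyadicBlock φ j) (dyadicBlock φ j).continuous)
    _ ≤ ∑' i, lpNorm 2 (P i) * (C * if |j - ℓ i| ≤ 2 then 1 else 0) :=
        ENNReal.tsum_le_tsum hblock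
    _ ≤ ∑' m : ℤ, A * 2 ^ (m * σ : ℝ) * (C * if |j - m| ≤ 2 then 1 else 0) :=
        tsum_mul_comp_le hPA fun m => C * if |j - m| ≤ 2 then 1 else 0
    _ = C * A * ∑' m : ℤ, 2 ^ (m * σ : ℝ) * (if |j - m| ≤ 2 then 1 else 0) := by
        rw [← ENNReal.tsum_mul_left]
        exact tsum_congr fun m => by ring
    _ ≤ C * A * ((2 * (2 : ℕ) + 1) * 2 ^ ((2 : ℕ) * |σ|) * 2 ^ (j * σ : ℝ)) := by
        gcongr
        exact tsum_two_rpow_window_le σ 2 j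
    _ = _ := by
        push_cast [ENNReal.coe_rpow_of_ne_zero two_ne_zero]
        ring

theorem exists_lpNorm_dyadicBlock_le_of_balls (hφ : Function.support φ ⊆ annulus N (3 / 4) (8 / 3))
    {r : ℝ≥0∞} (hr : 1 ≤ r) (hr2 : r ≤ 2) :
    ∃ C : ℝ≥0, ∀ (σ : ℝ) (ℓ : ι → ℤ) (P : ι → 𝓢'(RN N, ℂ)) (w : 𝓢'(RN N, ℂ)) (R : ℝ≥0∞),
      HasSum P w → (∀ i, HasSpectrumIn (P i) (Metric.closedBall 0 (3 * 2 ^ ℓ i))) →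
      (∀ j, ∑' i : {i | j ≤ ℓ i + 2}, lpNorm r (P i) ≤
        R * 2 ^ (j * (σ - N * (r.toReal⁻¹ - 2⁻¹)) : ℝ)) →
      ∀ j : ℤ, lpNorm 2 (dyadicBlock φ j w) ≤ C * R * 2 ^ (j * σ : ℝ) := by
  obtain ⟨C, hC⟩ := exists_lpNorm_fourierMultiplier_dilate_le φ hr hr2
  refine ⟨C, fun σ ℓ P w R hw hP hPR j => ?_⟩
  let D : ℝ≥0∞ := C * 2 ^ (j * (N * (r.toReal⁻¹ - 2⁻¹)) : ℝ)
  have hblock (i : ι) : lpNorm 2 (dyadicBlock φ j (P i)) ≤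
      D * {i | j ≤ ℓ i + 2}.indicator (fun i => lpNorm r (P i)) i := by
    by_cases hi : j ≤ ℓ i + 2
    · rw [Set.indicator_of_mem (by exact hi)]
      exact (hC j (P i)).trans_eq (by rw [ENNReal.toReal_ofNat])
    · rw [(hP i).dyadicBlock_eq_zero_of_closedBall hφ (not_le.1 hi), lpNorm_zero]
      exact zero_le
  calc lpNorm 2 (dyadicBlock φ j w)
      ≤ ∑' i, lpNorm 2 (dyadicBlock φ j (P i)) :=
        lpNorm_le_tsum one_le_two (hw.map (dyadicBlock φ j) (dyadicBlock φ j).continuous)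
    _ ≤ D * ∑' i : {i | j ≤ ℓ i + 2}, lpNorm r (P i) := by
        refine (ENNReal.tsum_le_tsum hblock).trans_eq ?_
        rw [ENNReal.tsum_mul_left]
        congr 1
        exact (tsum_subtype {i | j ≤ ℓ i + 2} _).symm
    _ ≤ D * (R * 2 ^ (j * (σ - N * (r.toReal⁻¹ - 2⁻¹)) : ℝ)) := by gcongr; exact hPR j
    _ = C * R * (2 ^ (j * (N * (r.toReal⁻¹ - 2⁻¹)) : ℝ) *
          2 ^ (j * (σ - N * (r.toReal⁻¹ - 2⁻¹)) : ℝ)) := by ring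
    _ = _ := by
        rw [← two_rpow_add]
        ring_nf

end Series

section Paraproduct

variable {N : ℕ} {φ : 𝓢(RN N, ℂ)} {p q r : ℝ≥0∞} {f g u v w : 𝓢'(RN N, ℂ)} {F G : ℤ → RN N → ℂ}
  {P : ℤ × ℤ → 𝓢'(RN N, ℂ)} {σ τ : ℝ}

theorem IsGivenBy.lpNorm_mul_le [p.HolderTriple q r] {h k : RN N → ℂ} (hu : IsGivenBy u h)
    (hv : IsGivenBy v k) (hw : IsGivenBy w fun x => h x * k x) :
    lpNorm r w ≤ lpNorm p u * lpNorm q v := by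
  rw [hu.lpNorm_eq, hv.lpNorm_eq, hw.lpNorm_eq]
  exact eLpNorm_smul_le_mul_eLpNorm (φ := h) hv.locallyIntegrable.aestronglyMeasurable
    hu.locallyIntegrable.aestronglyMeasurable

/-- Bernstein's inequality raises the exponent `p` of the factor with low frequencies to the
exponent conjugate to `q` with respect to `2`. -/
theorem exists_lpNorm_two_mul_le (N : ℕ) [p.HolderTriple q r] (hp : 1 ≤ p) (hq : 2 ≤ q)
    (hr : r ≤ 2) :
    ∃ C : ℝ≥0, ∀ (l : ℤ) (u v w : 𝓢'(RN N, ℂ)) (h k : RN N → ℂ),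
      HasSpectrumIn u (Metric.closedBall 0 (3 * 2 ^ l)) → IsGivenBy u h → IsGivenBy v k →
        IsGivenBy w (fun x => h x * k x) →
        lpNorm 2 w ≤ C * (2 ^ (l * (N * (r.toReal⁻¹ - 2⁻¹)) : ℝ) * lpNorm p u * lpNorm q v) := by
  have hpq := ENNReal.HolderTriple.inv_add_inv_eq_inv p q r
  have hq' : q⁻¹ ≤ 2⁻¹ := ENNReal.inv_le_inv.2 hq
  have hp' : p⁻¹ ≠ ∞ := ENNReal.inv_ne_top.2 (one_pos.trans_le hp).ne'
  have hq_top : q⁻¹ ≠ ∞ := ne_top_of_le_ne_top (by simp) hq'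
  set b : ℝ≥0∞ := (2⁻¹ - q⁻¹)⁻¹ with hb
  have : b.HolderTriple q 2 := ⟨by rw [hb, inv_inv, tsub_add_cancel_of_le hq']⟩
  have hpb : p ≤ b := by
    rw [hb, ENNReal.le_inv_iff_le_inv, tsub_le_iff_right, hpq]
    exact ENNReal.inv_le_inv.2 hr
  have hexp : p.toReal⁻¹ - b.toReal⁻¹ = r.toReal⁻¹ - 2⁻¹ := by
    rw [hb, ENNReal.toReal_inv, inv_inv, ENNReal.toReal_sub_of_le hq' (by simp),
      ← ENNReal.toReal_inv r, ← hpq, ENNReal.toReal_add hp' hq_top, ENNReal.toReal_inv,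
      ENNReal.toReal_inv, ENNReal.toReal_inv, ENNReal.toReal_ofNat]
    ring
  obtain ⟨C, hC⟩ := exists_lpNorm_le_of_hasSpectrumIn_closedBall N hp hpb
  refine ⟨C, fun l u v w h k hsu hu hv hw => ?_⟩
  calc lpNorm 2 w ≤ lpNorm b u * lpNorm q v := hu.lpNorm_mul_le hv hw
    _ ≤ C * 2 ^ (l * (N * (p.toReal⁻¹ - b.toReal⁻¹)) : ℝ) * lpNorm p u * lpNorm q v := by
        gcongr
        exact hC l u hsu
    _ = _ := by
        rw [hexp]
        ring

/-- The sequence of the `L^p` norms of the dyadic blocks of `f`. -/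
def blockNorm (φ : 𝓢(RN N, ℂ)) (p : ℝ≥0∞) (f : 𝓢'(RN N, ℂ)) (k : ℤ) : ℝ≥0∞ :=
  lpNorm p (dyadicBlock φ k f)

/-- The blocks of `f` and `g` are given by the functions `F k ∈ L^p` and `G l ∈ L^q`, and their
products define the tempered distributions `P (k, l)`. -/
structure HasBlockProducts (φ : 𝓢(RN N, ℂ)) (p q : ℝ≥0∞) (f g : 𝓢'(RN N, ℂ))
    (F G : ℤ → RN N → ℂ) (P : ℤ × ℤ → 𝓢'(RN N, ℂ)) : Prop where
  left : ∀ k, IsGivenBy (dyadicBlock φ k f) (F k)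
  left_memLp : ∀ k, MemLp (F k) p volume
  right : ∀ l, IsGivenBy (dyadicBlock φ l g) (G l)
  right_memLp : ∀ l, MemLp (G l) q volume
  mul : ∀ i, IsGivenBy (P i) fun x => F i.1 x * G i.2 x

theorem HasBlockProducts.swap (H : HasBlockProducts φ p q f g F G P) :
    HasBlockProducts φ q p g f G F (P ∘ Prod.swap) where
  left := H.right
  left_memLp := H.right_memLp
  right := H.left
  right_memLp := H.left_memLp
  mul i := by
    simpa only [Function.comp_apply, mul_comm, Prod.fst_swap, Prod.snd_swap] using H.mul i.swap

theorem exists_hasBlockProducts [p.HolderTriple q r] (hr : 1 ≤ r)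
    (hf : ∀ k, blockNorm φ p f k < ∞) (hg : ∀ l, blockNorm φ q g l < ∞) :
    ∃ F G P, HasBlockProducts φ p q f g F G P := by
  choose F hF hFp using fun k => exists_isGivenBy_memLp (hf k)
  choose G hG hGq using fun l => exists_isGivenBy_memLp (hg l)
  have : Fact (1 ≤ r) := ⟨hr⟩
  have hFG (i : ℤ × ℤ) : MemLp (fun x => F i.1 x * G i.2 x) r volume := (hGq i.2).mul (hFp i.1)
  exact ⟨F, G, fun i => Lp.toTemperedDistribution ((hFG i).toLp _), hF, hFp, hG, hGq,
    fun i => isGivenBy_toTemperedDistribution (hFG i)⟩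

theorem HasBlockProducts.isProduct (H : HasBlockProducts φ p q f g F G P) (hw : HasSum P w) :
    IsProduct φ f g w :=
  ⟨F, G, P, H.left, H.right, H.mul, hw⟩

/-- The pairs of block indices that contribute to the paraproduct `T_f g`. The product of two blocks
with supports in `{3/4 ≤ |ξ|/2^j ≤ 8/3}` has its spectrum in an annulus of radii comparable to
`2^l` once `k + 4 ≤ l`. -/
def lowHigh : Set (ℤ × ℤ) := {i | i.1 + 4 ≤ i.2}

/-- The pairs of block indices that contribute to the remainder `R(f, g)`. -/
def nearDiagonal : Set (ℤ × ℤ) := {i | |i.1 - i.2| ≤ 3}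

/-- The majorant `∑_{k ≤ l - 4} 2^{kω} a_k b_l` of the `l`-th term of a paraproduct, where `2^{kω}`
is the loss in Bernstein's inequality. -/
def paraproductSum (ω : ℝ) (a b : ℤ → ℝ≥0∞) (l : ℤ) : ℝ≥0∞ :=
  ∑' k : Set.Iic (l - 4), 2 ^ ((k : ℤ) * ω : ℝ) * a k * b l

/-- The majorant of the terms of the remainder that contribute to its `j`-th block. -/
def remainderSum (a b : ℤ → ℝ≥0∞) (j : ℤ) : ℝ≥0∞ :=
  ∑' i : {i : ℤ × ℤ | |i.1 - i.2| ≤ 3 ∧ j ≤ i.2 + 6}, a i.1.1 * b i.1.2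

theorem exists_paraproduct_estimate (hφ : Function.support φ ⊆ annulus N (3 / 4) (8 / 3))
    [p.HolderTriple q r] (hp : 1 ≤ p) (hq : 2 ≤ q) (hr : r ≤ 2) (hσ : -(N / 2 : ℝ) < σ) :
    ∃ C : ℝ≥0, ∀ {f g F G P} {A : ℝ≥0∞}, HasBlockProducts φ p q f g F G P → A ≠ ∞ →
      (∀ l, paraproductSum (N * (r.toReal⁻¹ - 2⁻¹)) (blockNorm φ p f)
        (blockNorm φ q g) l ≤ A * 2 ^ (l * σ : ℝ)) →
      ∃ w, HasSum (lowHigh.indicator P) w ∧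
        ∀ j, blockNorm φ 2 w j ≤ C * A * 2 ^ (j * σ : ℝ) := by
  obtain ⟨B, hB⟩ := exists_lpNorm_two_mul_le N (p := p) (q := q) (r := r) hp hq hr
  obtain ⟨C, hC⟩ := exists_lpNorm_dyadicBlock_le_of_annuli hφ σ fun i : lowHigh => i.1.2
  refine ⟨C * B, fun {f g F G P A} H hA hsum => ?_⟩
  have hspec (i : lowHigh) :
      HasSpectrumIn (P i) (annulus N (1 / 2 * 2 ^ i.1.2) (3 * 2 ^ i.1.2)) :=
    hasSpectrumIn_mul_blocks_of_add_four_le hφ (H.left _) (H.right _) (H.mul i) hp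
      (H.left_memLp _) i.2
  have hfiber (l : ℤ) : ∑' i : (fun i : lowHigh => i.1.2) ⁻¹' {l}, lpNorm 2 (P i) ≤
      B * A * 2 ^ (l * σ : ℝ) := by
    let ι (i : (fun i : lowHigh => i.1.2) ⁻¹' {l}) : Set.Iic (l - 4) :=
      ⟨i.1.1.1, by
        have hi : i.1.1.1 + 4 ≤ i.1.1.2 := i.1.2
        rw [show i.1.1.2 = l from i.2] at hi
        exact Set.mem_Iic.2 (by omega)⟩
    have hι : Function.Injective ι := fun i i' h =>
      Subtype.ext (Subtype.ext (Prod.ext (congrArg Subtype.val h) (i.2.trans i'.2.symm)))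
    rw [mul_assoc]
    refine le_trans ?_ (mul_le_mul_right (hsum l) (B : ℝ≥0∞))
    rw [paraproductSum, ← ENNReal.tsum_mul_left]
    refine (ENNReal.tsum_le_tsum fun i => ?_).trans
      (ENNReal.tsum_comp_le_tsum_of_injective hι _)
    have h := hB i.1.1.1 _ _ _ _ _ (hasSpectrumIn_dyadicBlock_closedBall hφ _ f) (H.left _)
      (H.right _) (H.mul i.1.1)
    rwa [show i.1.1.2 = l from i.2] at h
  obtain ⟨w, hw⟩ := exists_hasSum_of_annuli hσ (ENNReal.mul_ne_top ENNReal.coe_ne_top hA) hspec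
    hfiber
  refine ⟨w, hasSum_subtype_iff_indicator.1 hw, fun j => ?_⟩
  rw [ENNReal.coe_mul, mul_assoc (C : ℝ≥0∞)]
  exact hC _ w _ hw hspec hfiber j

theorem exists_remainder_estimate (hφ : Function.support φ ⊆ annulus N (3 / 4) (8 / 3))
    [p.HolderTriple q r] (hp : 1 ≤ p) (hr : 1 ≤ r) (hr2 : r ≤ 2) (hσ : -(N / 2 : ℝ) < σ) :
    ∃ C : ℝ≥0, ∀ {f g F G P} {R : ℝ≥0∞}, HasBlockProducts φ p q f g F G P → R ≠ ∞ →
      (∀ j, remainderSum (blockNorm φ p f) (blockNorm φ q g) j ≤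
        R * 2 ^ (j * (σ - N * (r.toReal⁻¹ - 2⁻¹)) : ℝ)) →
      ∃ w, HasSum (nearDiagonal.indicator P) w ∧
        ∀ j, blockNorm φ 2 w j ≤ C * R * 2 ^ (j * σ : ℝ) := by
  obtain ⟨C, hC⟩ := exists_lpNorm_dyadicBlock_le_of_balls (ι := nearDiagonal) hφ hr hr2
  refine ⟨C, fun {f g F G P R} H hR hsum => ?_⟩
  let ℓ (i : nearDiagonal) : ℤ := i.1.2 + 4
  have hspec (i : nearDiagonal) : HasSpectrumIn (P i) (Metric.closedBall 0 (3 * 2 ^ ℓ i)) :=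
    hasSpectrumIn_mul_blocks_of_le_add_three hφ (H.left _) (H.right _) (H.mul i) hp
      (H.left_memLp _) (by
        have hi : |i.1.1 - i.1.2| ≤ 3 := i.2
        rw [abs_le] at hi
        omega)
  have htail (j : ℤ) : ∑' i : {i | j ≤ ℓ i + 2}, lpNorm r (P i) ≤
      R * 2 ^ (j * (σ - N * (r.toReal⁻¹ - 2⁻¹)) : ℝ) := by
    let ι (i : {i | j ≤ ℓ i + 2}) : {i : ℤ × ℤ | |i.1 - i.2| ≤ 3 ∧ j ≤ i.2 + 6} :=
      ⟨i.1.1, i.1.2, by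
        have hi : j ≤ i.1.1.2 + 4 + 2 := i.2
        omega⟩
    have hι : Function.Injective ι := fun i i' h =>
      Subtype.ext (Subtype.ext (by simpa only [ι, Subtype.mk.injEq] using h))
    exact (ENNReal.tsum_le_tsum fun i => (H.left _).lpNorm_mul_le (H.right _) (H.mul _)).trans
      ((ENNReal.tsum_comp_le_tsum_of_injective hι fun i =>
        blockNorm φ p f i.1.1 * blockNorm φ q g i.1.2).trans (hsum j))
  obtain ⟨w, hw⟩ := exists_hasSum_of_balls hr hσ hR hspec htail
  exact ⟨w, hasSum_subtype_iff_indicator.1 hw, hC σ ℓ _ w R hw hspec htail⟩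

theorem indicator_bony_decomposition (P : ℤ × ℤ → 𝓢'(RN N, ℂ)) :
    lowHigh.indicator P + lowHigh.indicator (P ∘ Prod.swap) ∘ Prod.swap +
      nearDiagonal.indicator P = P := by
  funext ⟨k, l⟩
  simp only [Pi.add_apply, Function.comp_apply, Set.indicator_apply, lowHigh, nearDiagonal,
    Set.mem_ofPred_eq, Prod.swap_prod_mk, abs_le]
  split_ifs <;> first | omega | simp

theorem exists_isProduct_of_majorants (hφ : Function.support φ ⊆ annulus N (3 / 4) (8 / 3))
    [p.HolderTriple q r] (hp : 2 ≤ p) (hq : 2 ≤ q) (hr2 : r ≤ 2) (hσ : -(N / 2 : ℝ) < σ)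
    (hτ : -(N / 2 : ℝ) < τ) :
    ∃ C : ℝ≥0, ∀ {f g : 𝓢'(RN N, ℂ)} {A B R : ℝ≥0∞},
      (∀ k, blockNorm φ p f k < ∞) → (∀ l, blockNorm φ q g l < ∞) → A ≠ ∞ → B ≠ ∞ → R ≠ ∞ →
      (∀ l, paraproductSum (N * (r.toReal⁻¹ - 2⁻¹)) (blockNorm φ p f) (blockNorm φ q g) l ≤
        A * 2 ^ (l * σ : ℝ)) →
      (∀ k, paraproductSum (N * (r.toReal⁻¹ - 2⁻¹)) (blockNorm φ q g) (blockNorm φ p f) k ≤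
        B * 2 ^ (k * τ : ℝ)) →
      (∀ j, remainderSum (blockNorm φ p f) (blockNorm φ q g) j ≤
        R * 2 ^ (j * (σ - N * (r.toReal⁻¹ - 2⁻¹)) : ℝ)) →
      ∃ w, IsProduct φ f g w ∧ ∀ j, blockNorm φ 2 w j ≤
        C * ((A + R) * 2 ^ (j * σ : ℝ) + B * 2 ^ (j * τ : ℝ)) := by
  have hp1 : 1 ≤ p := one_le_two.trans hp
  have hr : 1 ≤ r := by
    rw [← ENNReal.inv_le_one, ← ENNReal.HolderTriple.inv_add_inv_eq_inv p q r,
      ← ENNReal.inv_two_add_inv_two]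
    gcongr
  have : q.HolderTriple p r := .symm
  obtain ⟨C₁, hC₁⟩ := exists_paraproduct_estimate (p := p) (q := q) hφ hp1 hq hr2 hσ
  obtain ⟨C₂, hC₂⟩ := exists_paraproduct_estimate (p := q) (q := p) hφ (one_le_two.trans hq) hp hr2
    hτ
  obtain ⟨C₃, hC₃⟩ := exists_remainder_estimate (p := p) (q := q) hφ hp1 hr hr2 hσ
  refine ⟨C₁ + C₂ + C₃, fun {f g A B R} hf hg hA hB hR hlow hhigh hdiag => ?_⟩
  obtain ⟨F, G, P, H⟩ := exists_hasBlockProducts hr hf hg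
  obtain ⟨w₁, hw₁, hle₁⟩ := hC₁ H hA hlow
  obtain ⟨w₂, hw₂, hle₂⟩ := hC₂ H.swap hB hhigh
  obtain ⟨w₃, hw₃, hle₃⟩ := hC₃ H hR hdiag
  have hw := (hw₁.add ((Equiv.prodComm ℤ ℤ).hasSum_iff.2 hw₂)).add hw₃
  refine ⟨w₁ + w₂ + w₃, H.isProduct (indicator_bony_decomposition P ▸ hw), fun j => ?_⟩
  calc blockNorm φ 2 (w₁ + w₂ + w₃) j
      ≤ blockNorm φ 2 w₁ j + blockNorm φ 2 w₂ j + blockNorm φ 2 w₃ j := by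
        simp only [blockNorm, map_add]
        exact (lpNorm_add_le one_le_two _ _).trans
          (add_le_add_left (lpNorm_add_le one_le_two _ _) _)
    _ ≤ C₁ * A * 2 ^ (j * σ : ℝ) + C₂ * B * 2 ^ (j * τ : ℝ) + C₃ * R * 2 ^ (j * σ : ℝ) :=
        add_le_add (add_le_add (hle₁ j) (hle₂ j)) (hle₃ j)
    _ ≤ (C₁ + C₂ + C₃) * A * 2 ^ (j * σ : ℝ) + (C₁ + C₂ + C₃) * B * 2 ^ (j * τ : ℝ) +
          (C₁ + C₂ + C₃) * R * 2 ^ (j * σ : ℝ) := by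
        gcongr
        · exact le_add_right le_self_add
        · exact le_add_right le_add_self
        · exact le_add_self
    _ = _ := by
        push_cast
        ring

end Paraproduct

section Majorants

variable {α β ω : ℝ} {a b : ℤ → ℝ≥0∞} {X Y : ℝ≥0∞}

theorem le_two_rpow_neg_mul {x : ℝ} {y z : ℝ≥0∞} (h : 2 ^ x * y ≤ z) : y ≤ 2 ^ (-x) * z := by
  calc y = 2 ^ (-x) * (2 ^ x * y) := by
        rw [← mul_assoc, ← two_rpow_add, neg_add_cancel, ENNReal.rpow_zero, one_mul]
    _ ≤ 2 ^ (-x) * z := by gcongr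

theorem paraproductSum_le_of_tsum_le (hα : α ≤ ω) (ha : ∑' k : ℤ, 2 ^ (k * α : ℝ) * a k ≤ X)
    (hb : ∀ l : ℤ, 2 ^ (l * β : ℝ) * b l ≤ Y) (l : ℤ) :
    paraproductSum ω a b l ≤ X * Y * 2 ^ (l * (ω - α - β) : ℝ) := by
  have hterm (k : Set.Iic (l - 4)) : 2 ^ ((k : ℤ) * ω : ℝ) * a k * b l ≤
      2 ^ ((k : ℤ) * α : ℝ) * a k * (Y * 2 ^ (l * (ω - α - β) : ℝ)) := by
    have hk : ((k : ℤ) : ℝ) ≤ l := by exact_mod_cast (Set.mem_Iic.1 k.2).trans (by omega)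
    calc 2 ^ ((k : ℤ) * ω : ℝ) * a k * b l
        ≤ 2 ^ (k * α + l * (ω - α) : ℝ) * a k * (2 ^ (-(l * β) : ℝ) * Y) := by
          gcongr
          · exact one_le_two
          · nlinarith
          · exact le_two_rpow_neg_mul (hb l)
      _ = 2 ^ ((k : ℤ) * α : ℝ) * a k * (Y * (2 ^ (l * (ω - α) : ℝ) * 2 ^ (-(l * β) : ℝ))) := by
          rw [two_rpow_add]
          ring
      _ = _ := by
          rw [← two_rpow_add]
          ring_nf
  calc paraproductSum ω a b l
      ≤ ∑' k : Set.Iic (l - 4), 2 ^ ((k : ℤ) * α : ℝ) * a k * (Y * 2 ^ (l * (ω - α - β) : ℝ)) :=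
        ENNReal.tsum_le_tsum hterm
    _ ≤ X * (Y * 2 ^ (l * (ω - α - β) : ℝ)) := by
        rw [ENNReal.tsum_mul_right]
        gcongr
        exact (ENNReal.tsum_comp_le_tsum_of_injective Subtype.val_injective
          fun k : ℤ => 2 ^ (k * α : ℝ) * a k).trans ha
    _ = _ := (mul_assoc _ _ _).symm

theorem tsum_Iic_two_rpow_le (s : ℝ) (l : ℤ) :
    ∑' k : Set.Iic l, (2 : ℝ≥0∞) ^ ((k : ℤ) * s : ℝ) ≤
      (∑' m : ℤ, 2 ^ (-(|(m : ℝ)| * s))) * 2 ^ (l * s : ℝ) := by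
  rw [← ENNReal.tsum_mul_right]
  refine (ENNReal.tsum_le_tsum fun k => ?_).trans (ENNReal.tsum_comp_le_tsum_of_injective
    (f := fun k : Set.Iic l => (k : ℤ) - l)
    ((sub_left_injective (b := l)).comp Subtype.val_injective) _)
  have hk : ((k : ℤ) : ℝ) ≤ l := by exact_mod_cast Set.mem_Iic.1 k.2
  rw [← two_rpow_add]
  push_cast
  rw [abs_of_nonpos (by linarith)]
  exact two_rpow_mono (by linarith)

theorem exists_paraproductSum_le (hα : α < ω) (β : ℝ) :
    ∃ C : ℝ≥0, ∀ {a b X Y}, (∀ k : ℤ, 2 ^ (k * α : ℝ) * a k ≤ X) →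
      (∀ l : ℤ, 2 ^ (l * β : ℝ) * b l ≤ Y) →
      ∀ l, paraproductSum ω a b l ≤ C * (X * Y) * 2 ^ (l * (ω - α - β) : ℝ) := by
  have hS := tsum_two_rpow_neg_abs_ne_top (sub_pos.2 hα)
  refine ⟨(∑' m : ℤ, (2 : ℝ≥0∞) ^ (-(|(m : ℝ)| * (ω - α)))).toNNReal, fun {a b X Y} ha hb l => ?_⟩
  rw [ENNReal.coe_toNNReal hS]
  set S := ∑' m : ℤ, (2 : ℝ≥0∞) ^ (-(|(m : ℝ)| * (ω - α)))
  have hterm (k : Set.Iic (l - 4)) : 2 ^ ((k : ℤ) * ω : ℝ) * a k * b l ≤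
      2 ^ ((k : ℤ) * (ω - α) : ℝ) * (X * (2 ^ (-(l * β) : ℝ) * Y)) := by
    calc 2 ^ ((k : ℤ) * ω : ℝ) * a k * b l
        ≤ 2 ^ ((k : ℤ) * ω : ℝ) * (2 ^ (-((k : ℤ) * α) : ℝ) * X) * (2 ^ (-(l * β) : ℝ) * Y) := by
          gcongr
          · exact le_two_rpow_neg_mul (ha k)
          · exact le_two_rpow_neg_mul (hb l)
      _ = 2 ^ ((k : ℤ) * ω : ℝ) * 2 ^ (-((k : ℤ) * α) : ℝ) * (X * (2 ^ (-(l * β) : ℝ) * Y)) := by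
          ring
      _ = _ := by
          rw [← two_rpow_add]
          ring_nf
  calc paraproductSum ω a b l
      ≤ (∑' k : Set.Iic (l - 4), 2 ^ ((k : ℤ) * (ω - α) : ℝ)) *
          (X * (2 ^ (-(l * β) : ℝ) * Y)) := by
        rw [← ENNReal.tsum_mul_right]
        exact ENNReal.tsum_le_tsum hterm
    _ ≤ S * 2 ^ (l * (ω - α) : ℝ) * (X * (2 ^ (-(l * β) : ℝ) * Y)) := by
        gcongr
        refine (tsum_Iic_two_rpow_le _ _).trans (mul_le_mul_right
          (two_rpow_mono (mul_le_mul_of_nonneg_right ?_ (sub_pos.2 hα).le)) S)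
        exact_mod_cast (by omega : l - 4 ≤ l)
    _ = S * (X * Y) * (2 ^ (l * (ω - α) : ℝ) * 2 ^ (-(l * β) : ℝ)) := by ring
    _ = _ := by
        rw [← two_rpow_add]
        ring_nf

theorem tsum_mul_two_rpow_window_le (x : ℤ → ℝ≥0∞) (s : ℝ) (n : ℕ) :
    ∑' i : ℤ × ℤ, x i.1 * (2 ^ (i.2 * s : ℝ) * if |i.1 - i.2| ≤ n then 1 else 0) ≤
      (2 * n + 1) * 2 ^ (n * |s|) * ∑' k : ℤ, x k * 2 ^ (k * s : ℝ) := by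
  rw [ENNReal.tsum_prod', ← ENNReal.tsum_mul_left]
  refine ENNReal.tsum_le_tsum fun k => ?_
  calc ∑' l : ℤ, x k * (2 ^ (l * s : ℝ) * if |k - l| ≤ n then 1 else 0)
      ≤ x k * ((2 * n + 1) * 2 ^ (n * |s|) * 2 ^ (k * s : ℝ)) := by
        rw [ENNReal.tsum_mul_left]
        gcongr
        exact tsum_two_rpow_window_le s n k
    _ = _ := by ring

theorem exists_remainderSum_le (hαβ : 0 ≤ α + β) :
    ∃ C : ℝ≥0, ∀ {a b X Y}, (∑' k : ℤ, 2 ^ (k * α : ℝ) * a k ≤ X) →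
      (∀ l : ℤ, 2 ^ (l * β : ℝ) * b l ≤ Y) →
      ∀ j : ℤ, remainderSum a b j ≤ C * (X * Y) * 2 ^ (-(j * (α + β)) : ℝ) := by
  refine ⟨2 ^ (9 * (α + β)) * ((2 * 3 + 1) * 2 ^ (3 * |-β|)), fun {a b X Y} ha hb j => ?_⟩
  let D : ℝ≥0∞ := 2 ^ (9 * (α + β)) * 2 ^ (-(j * (α + β)) : ℝ)
  have hterm (i : {i : ℤ × ℤ | |i.1 - i.2| ≤ 3 ∧ j ≤ i.2 + 6}) : a i.1.1 * b i.1.2 ≤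
      D * Y * (2 ^ (i.1.1 * (α + β) : ℝ) * a i.1.1 *
        (2 ^ (i.1.2 * -β : ℝ) * if |i.1.1 - i.1.2| ≤ (3 : ℕ) then 1 else 0)) := by
    obtain ⟨⟨k, l⟩, hkl, hj⟩ := i
    have hjk : (j : ℝ) ≤ k + 9 := by
      rw [abs_le] at hkl
      exact_mod_cast (by omega : j ≤ k + 9)
    rw [if_pos (by exact hkl), mul_one]
    calc a k * b l ≤ 2 ^ (9 * (α + β) + -(j * (α + β)) + k * (α + β)) * a k *
          (2 ^ (-(l * β) : ℝ) * Y) := by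
          refine mul_le_mul' (le_mul_of_one_le_left' ?_) (le_two_rpow_neg_mul (hb l))
          rw [← ENNReal.rpow_zero (x := 2)]
          exact two_rpow_mono (by nlinarith)
      _ = _ := by
          simp only [D, two_rpow_add, mul_neg]
          ring
  calc remainderSum a b j
      ≤ ∑' i : ℤ × ℤ, D * Y * (2 ^ (i.1 * (α + β) : ℝ) * a i.1 *
          (2 ^ (i.2 * -β : ℝ) * if |i.1 - i.2| ≤ (3 : ℕ) then 1 else 0)) :=
        (ENNReal.tsum_le_tsum hterm).trans (ENNReal.tsum_comp_le_tsum_of_injective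
          Subtype.val_injective fun i : ℤ × ℤ => D * Y * (2 ^ (i.1 * (α + β) : ℝ) * a i.1 *
            (2 ^ (i.2 * -β : ℝ) * if |i.1 - i.2| ≤ (3 : ℕ) then 1 else 0)))
    _ ≤ D * Y * ((2 * (3 : ℕ) + 1) * 2 ^ ((3 : ℕ) * |-β|) *
          ∑' k : ℤ, 2 ^ (k * (α + β) : ℝ) * a k * 2 ^ (k * -β : ℝ)) := by
        rw [ENNReal.tsum_mul_left]
        gcongr
        exact tsum_mul_two_rpow_window_le (fun k => 2 ^ (k * (α + β) : ℝ) * a k) (-β) 3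
    _ ≤ D * Y * ((2 * (3 : ℕ) + 1) * 2 ^ ((3 : ℕ) * |-β|) * X) := by
        gcongr
        refine (tsum_congr fun k => ?_).trans_le ha
        rw [mul_right_comm, ← two_rpow_add]
        ring_nf
    _ = _ := by
        push_cast [D, ENNReal.coe_rpow_of_ne_zero two_ne_zero]
        ring

end Majorants

section Besov

variable {N : ℕ} {φ : 𝓢(RN N, ℂ)} {f : 𝓢'(RN N, ℂ)} {s : ℝ} {p : ℝ≥0∞}

theorem besovNorm_one : besovNorm φ s p 1 f = ∑' k : ℤ, 2 ^ (k * s : ℝ) * blockNorm φ p f k := by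
  rw [besovNorm, eLpNorm_one_eq_lintegral_enorm, lintegral_count]
  rfl

theorem le_besovNorm_top (k : ℤ) : 2 ^ (k * s : ℝ) * blockNorm φ p f k ≤ besovNorm φ s p ∞ f := by
  have h := enorm_ae_le_eLpNormEssSup (fun k : ℤ => (2 : ℝ≥0∞) ^ (k * s : ℝ) * blockNorm φ p f k)
    Measure.count
  rw [Measure.ae_count_iff] at h
  rw [besovNorm, eLpNorm_exponent_top]
  exact h k

theorem besovNorm_top_le {c : ℝ≥0∞} (h : ∀ k : ℤ, 2 ^ (k * s : ℝ) * blockNorm φ p f k ≤ c) :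
    besovNorm φ s p ∞ f ≤ c := by
  rw [besovNorm, eLpNorm_exponent_top]
  exact eLpNormEssSup_le_of_ae_enorm_bound (.of_forall h)

theorem besovNormLow_top_le {k₀ : ℤ} {c : ℝ≥0∞}
    (h : ∀ k ≤ k₀, 2 ^ (k * s : ℝ) * blockNorm φ p f k ≤ c) : besovNormLow φ k₀ s p ∞ f ≤ c := by
  rw [besovNormLow, eLpNorm_exponent_top]
  refine eLpNormEssSup_le_of_ae_enorm_bound (.of_forall fun k => ?_)
  rw [enorm_eq_self]
  split_ifs with hk
  · exact h k hk
  · exact zero_le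

theorem MemBesov.blockNorm_lt_top (hf : MemBesov φ s p ∞ f) (k : ℤ) : blockNorm φ p f k < ∞ :=
  ENNReal.lt_top_of_mul_ne_top_right ((le_besovNorm_top k).trans_lt hf).ne (by simp)

theorem MemBesov.top_of_one (hf : MemBesov φ s p 1 f) : MemBesov φ s p ∞ f :=
  (besovNorm_top_le fun k => besovNorm_one ▸ ENNReal.le_tsum k).trans_lt hf

end Besov

section ProductEstimates

variable {N : ℕ} {φ : 𝓢(RN N, ℂ)} {p q r : ℝ≥0∞} {α β β' σ ω : ℝ}

/-- The norm with exponent `β'` enters only through the paraproduct `T_g f`. -/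
theorem exists_product_estimate (hφ : Function.support φ ⊆ annulus N (3 / 4) (8 / 3))
    [p.HolderTriple q r] (hp : 2 ≤ p) (hq : 2 ≤ q) (hr : r ≤ 2)
    (hω : N * (r.toReal⁻¹ - 2⁻¹) = ω) (hα : α ≤ ω) (hβ' : β' < ω) (hαβ : α + β + σ = ω)
    (hσω : σ ≤ ω) (hσ : -(N / 2 : ℝ) < σ) (hσ' : -(N / 2 : ℝ) < σ + (β - β')) :
    ∃ C : ℝ≥0, ∀ {f g : 𝓢'(RN N, ℂ)}, MemBesov φ α p 1 f → MemBesov φ β q ∞ g →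
      MemBesov φ β' q ∞ g → ∃ w, IsProduct φ f g w ∧ ∀ j : ℤ, 2 ^ (j * -σ : ℝ) * blockNorm φ 2 w j ≤
        C * besovNorm φ α p 1 f *
          (besovNorm φ β q ∞ g + besovNorm φ β' q ∞ g * 2 ^ (j * (β - β') : ℝ)) := by
  obtain ⟨C, hC⟩ := exists_isProduct_of_majorants (p := p) (q := q) (r := r) hφ hp hq hr hσ hσ'
  obtain ⟨C₂, hC₂⟩ := exists_paraproductSum_le hβ' α
  obtain ⟨C₃, hC₃⟩ := exists_remainderSum_le (α := α) (β := β) (by linarith)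
  rw [hω] at hC
  refine ⟨C * (1 + C₂ + C₃), fun {f g} hf hg hg' => ?_⟩
  have hX := (besovNorm_one (φ := φ) (f := f) (s := α) (p := p)).ge
  set X := besovNorm φ α p 1 f
  set Y := besovNorm φ β q ∞ g
  set Y' := besovNorm φ β' q ∞ g
  obtain ⟨w, hw, hle⟩ := hC (A := X * Y) (B := C₂ * (Y' * X)) (R := C₃ * (X * Y))
    hf.top_of_one.blockNorm_lt_top hg.blockNorm_lt_top
    (by finiteness) (by finiteness) (by finiteness)
    (fun l => (paraproductSum_le_of_tsum_le hα hX le_besovNorm_top l).trans_eq (by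
      rw [show ω - α - β = σ by linarith]))
    (fun k => (hC₂ le_besovNorm_top (fun l => (ENNReal.le_tsum l).trans hX) k).trans_eq (by
      rw [show ω - β' - α = σ + (β - β') by linarith]))
    (fun j => (hC₃ hX le_besovNorm_top j).trans_eq (by
      rw [← mul_neg, show -(α + β) = σ - ω by linarith]))
  refine ⟨w, hw, fun j => ?_⟩
  calc 2 ^ (j * -σ : ℝ) * blockNorm φ 2 w j
      ≤ 2 ^ (j * -σ : ℝ) * (C * ((X * Y + C₃ * (X * Y)) * 2 ^ (j * σ : ℝ) +
          C₂ * (Y' * X) * 2 ^ (j * (σ + (β - β')) : ℝ))) := by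
        gcongr
        exact hle j
    _ = 2 ^ (j * -σ + j * σ : ℝ) *
          (C * X * ((1 + C₃) * Y + C₂ * (Y' * 2 ^ (j * (β - β') : ℝ)))) := by
        simp only [mul_add, two_rpow_add]
        ring
    _ ≤ C * X * ((1 + C₂ + C₃) * Y + (1 + C₂ + C₃) * (Y' * 2 ^ (j * (β - β') : ℝ))) := by
        rw [mul_neg, neg_add_cancel, ENNReal.rpow_zero, one_mul]
        gcongr
        · exact le_self_add
        · exact le_add_right le_add_self
    _ = _ := by
        push_cast
        ring

theorem exists_square_estimate (hφ : Function.support φ ⊆ annulus N (3 / 4) (8 / 3))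
    [p.HolderTriple p r] (hp : 2 ≤ p) (hr : r ≤ 2)
    (hω : N * (r.toReal⁻¹ - 2⁻¹) = ω) (hα : α ≤ ω) (hαβ : α + β + σ = ω)
    (hσω : σ ≤ ω) (hσ : -(N / 2 : ℝ) < σ) :
    ∃ C : ℝ≥0, ∀ f : 𝓢'(RN N, ℂ), MemBesov φ α p 1 f → MemBesov φ β p ∞ f →
      ∃ w, IsProduct φ f f w ∧
        besovNorm φ (-σ) 2 ∞ w ≤ C * besovNorm φ α p 1 f * besovNorm φ β p ∞ f := by
  obtain ⟨C, hC⟩ := exists_isProduct_of_majorants (p := p) (q := p) (r := r) hφ hp hp hr hσ hσ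
  obtain ⟨C₃, hC₃⟩ := exists_remainderSum_le (α := α) (β := β) (by linarith)
  rw [hω] at hC
  refine ⟨C * (2 + C₃), fun f hf hf' => ?_⟩
  have hX := (besovNorm_one (φ := φ) (f := f) (s := α) (p := p)).ge
  set X := besovNorm φ α p 1 f
  set Y := besovNorm φ β p ∞ f
  have hlow (l : ℤ) : paraproductSum ω (blockNorm φ p f) (blockNorm φ p f) l ≤
      X * Y * 2 ^ (l * σ : ℝ) :=
    (paraproductSum_le_of_tsum_le hα hX le_besovNorm_top l).trans_eq (by
      rw [show ω - α - β = σ by linarith])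
  obtain ⟨w, hw, hle⟩ := hC (A := X * Y) (B := X * Y) (R := C₃ * (X * Y))
    hf'.blockNorm_lt_top hf'.blockNorm_lt_top (by finiteness) (by finiteness) (by finiteness)
    hlow hlow
    (fun j => (hC₃ hX le_besovNorm_top j).trans_eq (by
      rw [← mul_neg, show -(α + β) = σ - ω by linarith]))
  refine ⟨w, hw, besovNorm_top_le fun j => ?_⟩
  calc 2 ^ (j * -σ : ℝ) * blockNorm φ 2 w j
      ≤ 2 ^ (j * -σ : ℝ) * (C * ((X * Y + C₃ * (X * Y)) * 2 ^ (j * σ : ℝ) +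
          X * Y * 2 ^ (j * σ : ℝ))) := by
        gcongr
        exact hle j
    _ = 2 ^ (j * -σ + j * σ : ℝ) * (C * (2 + C₃) * X * Y) := by
        rw [two_rpow_add]
        ring
    _ = _ := by
        rw [mul_neg, neg_add_cancel, ENNReal.rpow_zero, one_mul]
        push_cast
        ring

theorem exists_besovNorm_product_le (hφ : Function.support φ ⊆ annulus N (3 / 4) (8 / 3))
    [p.HolderTriple q r] (hp : 2 ≤ p) (hq : 2 ≤ q) (hr : r ≤ 2)
    (hω : N * (r.toReal⁻¹ - 2⁻¹) = ω) (hα : α ≤ ω) (hβ : β < ω) (hαβ : α + β + σ = ω)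
    (hσω : σ ≤ ω) (hσ : -(N / 2 : ℝ) < σ) :
    ∃ C : ℝ≥0, ∀ f g : 𝓢'(RN N, ℂ), MemBesov φ α p 1 f → MemBesov φ β q ∞ g →
      ∃ w, IsProduct φ f g w ∧
        besovNorm φ (-σ) 2 ∞ w ≤ C * besovNorm φ α p 1 f * besovNorm φ β q ∞ g := by
  obtain ⟨C, hC⟩ := exists_product_estimate hφ hp hq hr hω hα hβ hαβ hσω hσ (by simpa using hσ)
  refine ⟨C * 2, fun f g hf hg => ?_⟩
  obtain ⟨w, hw, hle⟩ := hC hf hg hg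
  refine ⟨w, hw, besovNorm_top_le fun j => (hle j).trans_eq ?_⟩
  rw [sub_self, mul_zero, ENNReal.rpow_zero]
  push_cast
  ring

theorem exists_besovNormLow_product_le (hφ : Function.support φ ⊆ annulus N (3 / 4) (8 / 3))
    [p.HolderTriple q r] (hp : 2 ≤ p) (hq : 2 ≤ q) (hr : r ≤ 2)
    (hω : N * (r.toReal⁻¹ - 2⁻¹) = ω) (hα : α ≤ ω) (hβ' : β' < ω) (hββ' : β' ≤ β)
    (hαβ : α + β + σ = ω) (hσω : σ ≤ ω) (hσ : -(N / 2 : ℝ) < σ) (k₀ : ℤ) :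
    ∃ C : ℝ≥0, ∀ f g : 𝓢'(RN N, ℂ), MemBesov φ α p 1 f → MemBesov φ β q ∞ g →
      MemBesov φ β' q ∞ g → ∃ w, IsProduct φ f g w ∧ besovNormLow φ k₀ (-σ) 2 ∞ w ≤
        C * besovNorm φ α p 1 f * (besovNorm φ β q ∞ g + besovNorm φ β' q ∞ g) := by
  obtain ⟨C, hC⟩ := exists_product_estimate hφ hp hq hr hω hα hβ' hαβ hσω hσ (by linarith)
  refine ⟨C * (1 + 2 ^ (k₀ * (β - β'))), fun f g hf hg hg' => ?_⟩
  obtain ⟨w, hw, hle⟩ := hC hf hg hg'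
  refine ⟨w, hw, besovNormLow_top_le fun j hj => (hle j).trans ?_⟩
  have hj' : (2 : ℝ≥0∞) ^ (j * (β - β') : ℝ) ≤ 2 ^ (k₀ * (β - β') : ℝ) :=
    two_rpow_mono (mul_le_mul_of_nonneg_right (by exact_mod_cast hj) (sub_nonneg.2 hββ'))
  push_cast [ENNReal.coe_rpow_of_ne_zero two_ne_zero]
  set T : ℝ≥0∞ := 2 ^ (k₀ * (β - β') : ℝ)
  calc C * besovNorm φ α p 1 f *
        (besovNorm φ β q ∞ g + besovNorm φ β' q ∞ g * 2 ^ (j * (β - β') : ℝ))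
      ≤ C * besovNorm φ α p 1 f *
          (besovNorm φ β q ∞ g * (1 + T) + besovNorm φ β' q ∞ g * (1 + T)) := by
        gcongr
        · exact le_mul_of_one_le_right' le_self_add
        · exact hj'.trans le_add_self
    _ = _ := by ring

end ProductEstimates

section Exponents

variable {p q : ℝ}

theorem exists_holderTriple_ofReal (hp : 0 < p) (hq : 0 < q) (h : 2⁻¹ ≤ p⁻¹ + q⁻¹) :
    ∃ r, (ENNReal.ofReal p).HolderTriple (ENNReal.ofReal q) r ∧ r ≤ 2 ∧
      r.toReal⁻¹ = p⁻¹ + q⁻¹ := by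
  refine ⟨_, (Real.HolderTriple.of_pos hp hq).ennrealOfReal, ?_, ?_⟩
  · simpa using ENNReal.ofReal_le_ofReal (inv_le_of_inv_le₀ two_pos h)
  · rw [ENNReal.toReal_ofReal (by positivity), inv_inv]

theorem le_four_of_mul_le {N : ℕ} (hpN : p < N) (hp : (N - 2) * p ≤ 2 * N) : p ≤ 4 := by
  by_contra! h
  nlinarith

end Exponents

end LittlewoodPaley

end

open LittlewoodPaley in
theorem proposition3p4_general {N : ℕ} {p σ₁ : ℝ}
    (hp2 : 2 ≤ p) (hp4 : p ≤ 4) (hp : (N - 2) * p ≤ 2 * N)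
    (hσ : 1 - (N : ℝ) / 2 < σ₁) (hσ' : σ₁ ≤ 2 * N / p - N / 2)
    (φ : 𝓢(RN N, ℂ)) (hφ : IsDyadicGenerator φ) (k₀ : ℤ) :
    (∃ C : ℝ≥0, ∀ f g : 𝓢'(RN N, ℂ),
      MemBesov φ (N / p) (ENNReal.ofReal p) 1 f →
      MemBesov φ (-σ₁) 2 ∞ g →
      ∃ fg, IsProduct φ f g fg ∧
        besovNorm φ (-σ₁) 2 ∞ fg ≤
          C * besovNorm φ (N / p) (ENNReal.ofReal p) 1 f * besovNorm φ (-σ₁) 2 ∞ g) ∧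
    (∃ C : ℝ≥0, ∀ f g : 𝓢'(RN N, ℂ),
      MemBesov φ (N / p - 1) (ENNReal.ofReal p) 1 f →
      MemBesov φ (-σ₁ + N / p - N / 2 + 1) (ENNReal.ofReal p) ∞ g →
      MemBesov φ (-σ₁ + 2 * N / p - N + 1) (ENNReal.ofReal p) ∞ g →
      ∃ fg, IsProduct φ f g fg ∧
        besovNormLow φ k₀ (-σ₁) 2 ∞ fg ≤
          C * besovNorm φ (N / p - 1) (ENNReal.ofReal p) 1 f *
            (besovNorm φ (-σ₁ + N / p - N / 2 + 1) (ENNReal.ofReal p) ∞ g +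
              besovNorm φ (-σ₁ + 2 * N / p - N + 1) (ENNReal.ofReal p) ∞ g)) ∧
    (∃ C : ℝ≥0, ∀ f g : 𝓢'(RN N, ℂ),
      MemBesov φ (N / p - 2) (ENNReal.ofReal p) 1 f →
      MemBesov φ (-σ₁ + N / p - N / 2 + 2) (ENNReal.ofReal p) ∞ g →
      MemBesov φ (-σ₁ + 2 * N / p - N + 1) (ENNReal.ofReal p) ∞ g →
      ∃ fg, IsProduct φ f g fg ∧
        besovNormLow φ k₀ (-σ₁) 2 ∞ fg ≤
          C * besovNorm φ (N / p - 2) (ENNReal.ofReal p) 1 f *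
            (besovNorm φ (-σ₁ + N / p - N / 2 + 2) (ENNReal.ofReal p) ∞ g +
              besovNorm φ (-σ₁ + 2 * N / p - N + 1) (ENNReal.ofReal p) ∞ g)) ∧
    (∃ C : ℝ≥0, ∀ f : 𝓢'(RN N, ℂ),
      MemBesov φ (N / p - 2) (ENNReal.ofReal p) 1 f →
      MemBesov φ (-σ₁ + N / p - N / 2 + 2) (ENNReal.ofReal p) ∞ f →
      ∃ ff, IsProduct φ f f ff ∧
        besovNorm φ (-σ₁) 2 ∞ ff ≤
          C * besovNorm φ (N / p - 2) (ENNReal.ofReal p) 1 f *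
            besovNorm φ (-σ₁ + N / p - N / 2 + 2) (ENNReal.ofReal p) ∞ f) ∧
    (∃ C : ℝ≥0, ∀ f : 𝓢'(RN N, ℂ),
      MemBesov φ (N / p - 1) (ENNReal.ofReal p) 1 f →
      MemBesov φ (-σ₁ + N / p - N / 2 + 1) (ENNReal.ofReal p) ∞ f →
      ∃ ff, IsProduct φ f f ff ∧
        besovNorm φ (-σ₁) 2 ∞ ff ≤
          C * besovNorm φ (N / p - 1) (ENNReal.ofReal p) 1 f *
            besovNorm φ (-σ₁ + N / p - N / 2 + 1) (ENNReal.ofReal p) ∞ f) := by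
  have hp0 : 0 < p := zero_lt_two.trans_le hp2
  have hp2' : 2 ≤ ENNReal.ofReal p := by simpa using ENNReal.ofReal_le_ofReal hp2
  have hPN : (N : ℝ) / 2 - 1 ≤ N / p := by
    rw [le_div_iff₀ hp0]
    linarith
  have hP2 : (N : ℝ) / p ≤ N / 2 := by gcongr
  obtain ⟨r, h₂, hr, hr_inv⟩ := exists_holderTriple_ofReal hp0 two_pos (by simpa using hp0.le)
  obtain ⟨r', _, hr', hr'_inv⟩ := exists_holderTriple_ofReal hp0 hp0 (by
    linarith [inv_anti₀ hp0 hp4])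
  rw [ENNReal.ofReal_ofNat] at h₂
  have hω : N * (r.toReal⁻¹ - 2⁻¹) = N / p := by rw [hr_inv]; ring
  have hω' : N * (r'.toReal⁻¹ - 2⁻¹) = 2 * (N / p) - N / 2 := by rw [hr'_inv]; ring
  rw [mul_div_assoc] at hσ' ⊢
  refine ⟨?_, ?_, ?_, ?_, ?_⟩
  · exact exists_besovNorm_product_le hφ.support hp2' le_rfl hr hω le_rfl (by linarith)
      (by ring) (by linarith) (by linarith)
  · exact exists_besovNormLow_product_le hφ.support hp2' hp2' hr' hω' (by linarith) (by linarith)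
      (by linarith) (by ring) hσ' (by linarith) k₀
  · exact exists_besovNormLow_product_le hφ.support hp2' hp2' hr' hω' (by linarith) (by linarith)
      (by linarith) (by ring) hσ' (by linarith) k₀
  · exact exists_square_estimate hφ.support hp2' hr' hω' (by linarith) (by ring) hσ' (by linarith)
  · exact exists_square_estimate hφ.support hp2' hr' hω' (by linarith) (by ring) hσ' (by linarith)

open LittlewoodPaley in
theorem proposition3p4 {N : ℕ} {p σ₁ : ℝ}
    (hp2 : 2 ≤ p) (hpN : p < N) (hp : p ≤ 2 * N / (N - 2))
    (hσ : 1 - (N : ℝ) / 2 < σ₁) (hσ' : σ₁ ≤ 2 * N / p - N / 2)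
    (φ : 𝓢(RN N, ℂ)) (hφ : IsDyadicGenerator φ) (k₀ : ℤ) :
    (∃ C : ℝ≥0, ∀ f g : 𝓢'(RN N, ℂ),
      MemBesov φ (N / p) (ENNReal.ofReal p) 1 f →
      MemBesov φ (-σ₁) 2 ∞ g →
      ∃ fg, IsProduct φ f g fg ∧
        besovNorm φ (-σ₁) 2 ∞ fg ≤
          C * besovNorm φ (N / p) (ENNReal.ofReal p) 1 f * besovNorm φ (-σ₁) 2 ∞ g) ∧
    (∃ C : ℝ≥0, ∀ f g : 𝓢'(RN N, ℂ),
      MemBesov φ (N / p - 1) (ENNReal.ofReal p) 1 f →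
      MemBesov φ (-σ₁ + N / p - N / 2 + 1) (ENNReal.ofReal p) ∞ g →
      MemBesov φ (-σ₁ + 2 * N / p - N + 1) (ENNReal.ofReal p) ∞ g →
      ∃ fg, IsProduct φ f g fg ∧
        besovNormLow φ k₀ (-σ₁) 2 ∞ fg ≤
          C * besovNorm φ (N / p - 1) (ENNReal.ofReal p) 1 f *
            (besovNorm φ (-σ₁ + N / p - N / 2 + 1) (ENNReal.ofReal p) ∞ g +
              besovNorm φ (-σ₁ + 2 * N / p - N + 1) (ENNReal.ofReal p) ∞ g)) ∧
    (∃ C : ℝ≥0, ∀ f g : 𝓢'(RN N, ℂ),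
      MemBesov φ (N / p - 2) (ENNReal.ofReal p) 1 f →
      MemBesov φ (-σ₁ + N / p - N / 2 + 2) (ENNReal.ofReal p) ∞ g →
      MemBesov φ (-σ₁ + 2 * N / p - N + 1) (ENNReal.ofReal p) ∞ g →
      ∃ fg, IsProduct φ f g fg ∧
        besovNormLow φ k₀ (-σ₁) 2 ∞ fg ≤
          C * besovNorm φ (N / p - 2) (ENNReal.ofReal p) 1 f *
            (besovNorm φ (-σ₁ + N / p - N / 2 + 2) (ENNReal.ofReal p) ∞ g +
              besovNorm φ (-σ₁ + 2 * N / p - N + 1) (ENNReal.ofReal p) ∞ g)) ∧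
    (∃ C : ℝ≥0, ∀ f : 𝓢'(RN N, ℂ),
      MemBesov φ (N / p - 2) (ENNReal.ofReal p) 1 f →
      MemBesov φ (-σ₁ + N / p - N / 2 + 2) (ENNReal.ofReal p) ∞ f →
      ∃ ff, IsProduct φ f f ff ∧
        besovNorm φ (-σ₁) 2 ∞ ff ≤
          C * besovNorm φ (N / p - 2) (ENNReal.ofReal p) 1 f *
            besovNorm φ (-σ₁ + N / p - N / 2 + 2) (ENNReal.ofReal p) ∞ f) ∧
    (∃ C : ℝ≥0, ∀ f : 𝓢'(RN N, ℂ),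
      MemBesov φ (N / p - 1) (ENNReal.ofReal p) 1 f →
      MemBesov φ (-σ₁ + N / p - N / 2 + 1) (ENNReal.ofReal p) ∞ f →
      ∃ ff, IsProduct φ f f ff ∧
        besovNorm φ (-σ₁) 2 ∞ ff ≤
          C * besovNorm φ (N / p - 1) (ENNReal.ofReal p) 1 f *
            besovNorm φ (-σ₁ + N / p - N / 2 + 1) (ENNReal.ofReal p) ∞ f) := by
  have hp' : (N - 2) * p ≤ 2 * N := (le_div_iff₀' (by linarith)).1 hp
  exact proposition3p4_general hp2 (le_four_of_mul_le hpN hp') hp' hσ hσ' φ hφ k₀
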